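/- Let $m\ge 9$ be an integer. On $[-1,1]$ let $\varphi_0=1$ and $\varphi_k=\sqrt2\,T_k$ for $1\le k\le m$, where $T_k(x)=\cos(k\arccos x)$ is the $k$-th Chebyshev polynomial of the first kind, and put $\Phi=(\varphi_0,\dots,\varphi_m)$. Let $$\Delta=\sum_{j=1}^{s}\Delta_j e^{\mathrm i\theta_j}\delta_{T_j},\qquad \Delta_j>0,\ \theta_j\in\mathbb R,$$ be a discrete complex measure on $[-1,1]$ with support $\mathbf S=\{T_1,\dots,T_s\}$ (the $T_j$ distinct). Let $c_0>0$ and assume that every point of $\mathbf S$ is at distance at least $2c_0$ from each of $-1$ and $1$. Assume that $\mathbf S$ satisfies $\mathrm{QIC}(C_a,C_b)$ with $C_a>0$, $0<C_b<1$ and $C_b/C_a\le c_0^2$; that is, for all real $\vartheta_1,\dots,\vartheta_s$ there is a complex linear combination $P$ of $\varphi_0,\dots,\varphi_m$ with $P(T_k)=e^{-\mathrm i\vartheta_k}$ for all $k$ and $$1-|P(x)|\ \ge\ \min_{T\in\mathbf S}\min\{C_a m^2|x-T|^2,\;C_b\}\qquad\text{for all }x\in[-1,1].$$ Let $\varepsilon_0,\dots,\varepsilon_m$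 be i.i.d. real centered Gaussian random variables with standard deviation $\sigma>0$, let $y=\int\Phi\,d\Delta+\varepsilon$, and let $$\lambda\ \ge\ \lambda_M:=\sigma\sqrt{6m\log m}.$$ Then, with probability greater than $$1-\frac{8\sqrt6}{\sqrt{2\pi}}\,\frac{\lambda}{\lambda_M}\sqrt{\log m}\;\exp\Big[-\Big(2\frac{\lambda^2}{\lambda_M^2}-1\Big)\log m\Big],$$ the following holds for every solution $\hat\Delta$ of $$\hat\Delta\in\arg\min_{\mu}\ \tfrac12\Big\|\int\Phi\,d\mu-y\Big\|_2^2+\lambda\|\mu\|_{TV},$$ where $\mu$ ranges over all complex Borel measures on $[-1,1]$ and $\|\cdot\|_{TV}$ is the total variation norm. * For every $x\in[-1,1]$ with $|\hat\Delta(\{x\})|>2\lambda/C_b$ there is a unique $T\in\mathbf S$ such that $$|x-T|\le\Big[\frac{2\lambda}{C_a|\hat\Delta(\{x\})|}\Big]^{1/2}\frac1m,$$ and the right-hand side is at most $c_0/m$. * Let $C'=2+\max\Big\{\frac{2(1-C_b)}{C_b},\frac{4}{C_a-C_b}\Big\}$. For every $j$ with $\Delta_j>C'\lambda$ there is $\hat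 T\in\mathrm{Supp}(\hat\Delta)$ such that $$|T_j-\hat T|\le\Big[\frac{2\lambda}{C_a(\Delta_j-C'\lambda)}\Big]^{1/2}\frac1m.$$ -/

import Mathlib

open MeasureTheory ProbabilityTheory

noncomputable section

namespace MomentBlasso

/-- The compact metric space `[-1, 1]`, with `d(x, y) = |x - y|`. -/
abbrev Dom : Type := Set.Icc (-1 : ℝ) 1

/-- The Chebyshev family: `φ₀ = 1` and `φₖ = √2 Tₖ` for `k ≥ 1`, as functions on `[-1, 1]`,
with `Tₖ` the Chebyshev polynomial of the first kind. -/
def cheb (k : ℕ) (x : Dom) : ℝ :=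
  if k = 0 then 1 else Real.sqrt 2 * (Polynomial.Chebyshev.T ℝ (k : ℤ)).eval (x : ℝ)

/-- The complex linear span of `φ₀, …, φₘ`. -/
def chebSpan (m : ℕ) : Submodule ℂ (Dom → ℂ) :=
  Submodule.span ℂ (Set.range fun (k : Fin (m + 1)) (x : Dom) => (cheb k x : ℂ))

/-- The quadratic isolation condition `QIC(Ca, Cb)` for the points `T 1, …, T s`.
The infimum over the finite index set is the minimum over the points. -/
def QIC (m : ℕ) {s : ℕ} (T : Fin s → Dom) (Ca Cb : ℝ) : Prop :=
  0 < Ca ∧ 0 < Cb ∧ Cb < 1 ∧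
    ∀ θ : Fin s → ℝ, ∃ P ∈ chebSpan m,
      (∀ k, P (T k) = Complex.exp (-(Complex.I * (θ k : ℂ)))) ∧
      ∀ x : Dom,
        (⨅ k, min (Ca * (m : ℝ) ^ 2 * dist x (T k) ^ 2) Cb) ≤ 1 - ‖P x‖

/-- The discrete complex measure `∑ₖ aₖ exp(i θₖ) δ_{Tₖ}`. -/
def spikes {s : ℕ} (T : Fin s → Dom) (a θ : Fin s → ℝ) : ComplexMeasure Dom :=
  ∑ k, VectorMeasure.dirac (T k) ((a k : ℂ) * Complex.exp (Complex.I * (θ k : ℂ)))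

/-- The generalized moment `cₖ(μ) = ∫ φₖ dμ`. -/
def moment (k : ℕ) (μ : ComplexMeasure Dom) : ℂ :=
  μ.integral (cheb k) (ContinuousLinearMap.lsmul ℝ ℝ)

/-- The total variation norm of a complex measure. -/
def tvNorm (μ : ComplexMeasure Dom) : ℝ :=
  μ.variation.real Set.univ

/-- The objective `½ ‖∫ Φ dμ - y‖₂² + lam ‖μ‖_TV`. -/
def objective (m : ℕ) (lam : ℝ) (y : Fin (m + 1) → ℂ) (μ : ComplexMeasure Dom) : ℝ :=
  1 / 2 * ∑ k : Fin (m + 1), ‖moment k μ - y k‖ ^ 2 + lam * tvNorm μ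

/-- `μ` is a solution of BLASSO: it minimizes the objective over all complex measures. -/
def IsSolution (m : ℕ) (lam : ℝ) (y : Fin (m + 1) → ℂ) (μ : ComplexMeasure Dom) : Prop :=
  ∀ ν : ComplexMeasure Dom, objective m lam y μ ≤ objective m lam y ν

/-- The topological support of a complex measure. -/
def supp (μ : ComplexMeasure Dom) : Set Dom := μ.variation.support

/-- The threshold `σ √(6 m log m)`. -/
def lamM (m : ℕ) (σ : ℝ) : ℝ := σ * Real.sqrt (6 * m * Real.log m)

/-- The constant `C' = 2 + max {2 (1 - Cb) / Cb, 4 / (Ca - Cb)}`. -/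
def constC' (Ca Cb : ℝ) : ℝ := 2 + max (2 * (1 - Cb) / Cb) (4 / (Ca - Cb))

end MomentBlasso

end

/-! The argument is deterministic on the event that the noise has Euclidean norm at most λ; Gaussian
tails and a union bound over the coordinates give this event its probability.

Let ν be the target, μ a solution, H the moments of μ - ν, and N the Euclidean norm of H. Let P be
the QIC polynomial whose phases cancel those of ν, so that ∫ P dν = ∑ Δ_j. Since |P| ≤ 1 and the
family is orthonormal for the normalized arcsine measure, the coefficients of P have norm at most 1
(`sum_norm_sq_le_one`), whence |∫ P d(μ - ν)| ≤ N. Optimality of μ along the segment to ν then gives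
λ(‖μ‖ - Re ∫ P dμ) ≤ 2λN - N². Hence the defect ‖μ‖ - Re ∫ P dμ is at most λ, and N ≤ 2λ
(`IsCertificate.defect_le`).

An atom at x contributes at least |μ{x}|(1 - |P(x)|) to the defect, so a large atom must lie where
the quadratic branch of QIC is active. The nearby spike is unique because spikes are 2c₀/m apart: a
certificate taking the values 1 and -1 at two of them has to vary at the rate that Bernstein's
inequality permits.

For a large spike T_j, let Q be a certificate with the phase at T_j shifted by π, so that ∫ (P - Q)
dν = 2Δ_j. The key estimate is |(1 + L)P - Q| ≤ L outside a neighborhood of T_j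
(`norm_certificate_combination_le`). Near the other spikes P and Q agree to first order, and the
first and second order Bernstein bounds control the loss. If the support of μ missed the
neighborhood, then Re ∫ (P - Q) dμ ≤ L(‖μ‖ - Re ∫ P dμ) ≤ Lλ, whereas the left side is at least 2Δ_j
- 4λ; the choice of L makes this impossible. -/

noncomputable section

namespace MomentBlasso

/-! ### Complex measures: moments, total variation, integration of polynomials -/

/-- Every complex measure has finite total variation. -/
instance isFiniteMeasure_variation {X : Type*} [MeasurableSpace X] (μ : ComplexMeasure X) :
    IsFiniteMeasure μ.variation := by
  have h : μ.variation ≤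
      (ComplexMeasure.re μ).totalVariation + (ComplexMeasure.im μ).totalVariation := by
    refine VectorMeasure.variation_le_of_forall_enorm_le fun s _ => ?_
    have h1 : ‖μ s‖ₑ ≤ ‖(μ s).re‖ₑ + ‖(μ s).im‖ₑ := by
      have := Complex.norm_le_abs_re_add_abs_im (μ s)
      rw [← ofReal_norm, ← ofReal_norm, ← ofReal_norm,
        ← ENNReal.ofReal_add (norm_nonneg _) (norm_nonneg _)]
      exact ENNReal.ofReal_le_ofReal this
    refine h1.trans (add_le_add ?_ ?_)
    · exact SignedMeasure.enorm_le_totalVariation (ComplexMeasure.re μ) s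
    · exact SignedMeasure.enorm_le_totalVariation (ComplexMeasure.im μ) s
  exact isFiniteMeasure_of_le _ h

theorem mul_integral_lsmul {X : Type*} [MeasurableSpace X] (μ : ComplexMeasure X) (c : ℂ)
    {f : X → ℝ} (hf : Integrable f μ.variation) :
    c * μ.integral f (ContinuousLinearMap.lsmul ℝ ℝ) =
      μ.integral (fun x => c * (f x : ℂ)) (ContinuousLinearMap.mul ℝ ℂ) := by
  have h1 := VectorMeasure.continuousLinearMap_apply_integral
    (B := ContinuousLinearMap.lsmul ℝ ℝ) (C := ContinuousLinearMap.mul ℝ ℂ c) hf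
  have h2 := VectorMeasure.integral_continuousLinearMap_comp
    (B := ContinuousLinearMap.mul ℝ ℂ)
    (C := (ContinuousLinearMap.mul ℝ ℂ c).comp Complex.ofRealCLM) hf
  simp only [ContinuousLinearMap.mul_apply', ContinuousLinearMap.comp_apply,
    Complex.ofRealCLM_apply] at h1 h2
  rw [h1, h2]
  congr 1
  ext
  simp

@[fun_prop]
theorem continuous_cheb (k : ℕ) : Continuous (cheb k) := by
  unfold cheb
  split_ifs <;> fun_prop

theorem integrable_of_continuous {E : Type*} [NormedAddCommGroup E]
    [SecondCountableTopology E] [MeasurableSpace E] [BorelSpace E] {ν : Measure Dom}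
    [IsFiniteMeasure ν] {f : Dom → E} (hf : Continuous f) : Integrable f ν :=
  (BoundedContinuousFunction.mkOfCompact ⟨f, hf⟩).integrable ν

/-- The polynomial `∑ₖ αₖ φₖ`. -/
def chebSum {m : ℕ} (α : Fin (m + 1) → ℂ) (x : Dom) : ℂ := ∑ k, α k * (cheb k x : ℂ)

@[fun_prop]
theorem continuous_chebSum {m : ℕ} (α : Fin (m + 1) → ℂ) : Continuous (chebSum α) := by
  unfold chebSum
  fun_prop

theorem exists_chebSum_of_mem_chebSpan {m : ℕ} {P : Dom → ℂ} (hP : P ∈ chebSpan m) :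
    ∃ α : Fin (m + 1) → ℂ, P = chebSum α := by
  obtain ⟨α, rfl⟩ := (Submodule.mem_span_range_iff_exists_fun ℂ).1 hP
  refine ⟨α, ?_⟩
  ext x
  simp [chebSum]

theorem sum_mul_moment_eq_integral {m : ℕ} (α : Fin (m + 1) → ℂ) (μ : ComplexMeasure Dom) :
    ∑ k : Fin (m + 1), α k * moment k μ =
      μ.integral (chebSum α) (ContinuousLinearMap.mul ℝ ℂ) := by
  unfold chebSum
  rw [VectorMeasure.integral_finsetSum _ fun k _ =>
    integrable_of_continuous (ν := μ.variation) (by fun_prop)]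
  exact Finset.sum_congr rfl fun k _ =>
    mul_integral_lsmul μ (α k) (integrable_of_continuous (continuous_cheb k))

theorem norm_sum_mul_moment_le {m : ℕ} (α : Fin (m + 1) → ℂ) (μ : ComplexMeasure Dom) :
    ‖∑ k : Fin (m + 1), α k * moment k μ‖ ≤ ∫ x, ‖chebSum α x‖ ∂μ.variation := by
  rw [sum_mul_moment_eq_integral]
  refine VectorMeasure.norm_integral_le_integral_norm.trans ?_
  have h : ‖ContinuousLinearMap.mul ℝ ℂ‖ ≤ 1 := ContinuousLinearMap.opNorm_mul_le ℝ ℂ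
  exact mul_le_of_le_one_left (integral_nonneg fun _ => norm_nonneg _) h

theorem moment_add (k : ℕ) (μ ν : ComplexMeasure Dom) :
    moment k (μ + ν) = moment k μ + moment k ν :=
  VectorMeasure.integral_add_vectorMeasure (integrable_of_continuous (continuous_cheb k))
    (integrable_of_continuous (continuous_cheb k))

theorem moment_smul (k : ℕ) (c : ℝ) (μ : ComplexMeasure Dom) :
    moment k (c • μ) = c * moment k μ :=
  (VectorMeasure.integral_smul_vectorMeasure (cheb k) c).trans Complex.real_smul

theorem tvNorm_add_le (μ ν : ComplexMeasure Dom) : tvNorm (μ + ν) ≤ tvNorm μ + tvNorm ν := by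
  unfold tvNorm
  rw [← measureReal_add_apply]
  exact ENNReal.toReal_mono (measure_ne_top _ _) (VectorMeasure.variation_add_le _)

theorem tvNorm_smul (c : ℝ) (μ : ComplexMeasure Dom) : tvNorm (c • μ) = |c| * tvNorm μ := by
  unfold tvNorm
  rw [VectorMeasure.variation_smul, measureReal_nnreal_smul_apply]
  simp

theorem moment_spikes {s : ℕ} (T : Fin s → Dom) (a θ : Fin s → ℝ) (k : ℕ) :
    moment k (spikes T a θ) =
      ∑ j, (cheb k (T j) : ℂ) * (a j * Complex.exp (Complex.I * (θ j : ℂ))) := by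
  unfold moment spikes
  rw [VectorMeasure.integral_finsetSum_vectorMeasure fun _ _ =>
    integrable_of_continuous (continuous_cheb k)]
  simp [VectorMeasure.integral_dirac]

theorem tvNorm_spikes_le {s : ℕ} (T : Fin s → Dom) {a : Fin s → ℝ} (ha : ∀ j, 0 ≤ a j)
    (θ : Fin s → ℝ) : tvNorm (spikes T a θ) ≤ ∑ j, a j := by
  unfold tvNorm spikes
  have h := VectorMeasure.variation_finsetSum_le (V := ℂ) Finset.univ fun j =>
    VectorMeasure.dirac (T j) ((a j : ℂ) * Complex.exp (Complex.I * (θ j : ℂ)))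
  refine ENNReal.toReal_le_of_le_ofReal (Finset.sum_nonneg fun j _ => ha j) ((h _).trans ?_)
  rw [ENNReal.ofReal_sum_of_nonneg fun j _ => ha j]
  simp only [VectorMeasure.variation_dirac, Measure.coe_finsetSum, Finset.sum_apply,
    Measure.smul_apply, measure_univ, smul_eq_mul, mul_one]
  refine Finset.sum_le_sum fun j _ => le_of_eq ?_
  rw [← ofReal_norm, norm_mul, mul_comm Complex.I, Complex.norm_exp_ofReal_mul_I]
  simp [abs_of_nonneg (ha j)]

theorem sum_mul_moment_spikes {m s : ℕ} (α : Fin (m + 1) → ℂ) (T : Fin s → Dom)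
    (a θ : Fin s → ℝ) :
    ∑ k : Fin (m + 1), α k * moment k (spikes T a θ) =
      ∑ j, chebSum α (T j) * (a j * Complex.exp (Complex.I * (θ j : ℂ))) := by
  simp_rw [moment_spikes, chebSum, Finset.mul_sum, Finset.sum_mul]
  rw [Finset.sum_comm]
  simp_rw [mul_assoc]

/-! ### M. Riesz's interpolation formula -/

/-- The nodes of the interpolation formula of M. Riesz. -/
def rieszNode (m r : ℕ) : ℝ := (2 * r + 1) * Real.pi / (2 * m)

open Complex in
/-- The squared modulus of the Dirichlet sum at a node, i.e. `m` times the Fejér kernel. -/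
def rieszFejer (m r : ℕ) : ℝ := ‖∑ j ∈ Finset.range m, exp (I * (j * rieszNode m r))‖ ^ 2

/-- The weights of the interpolation formula of M. Riesz. -/
def rieszWeight (m r : ℕ) : ℝ := (-1) ^ r * rieszFejer m r / (2 * m)

-- The nodes are equally spaced by π/m, so this is a full geometric sum over a nontrivial root of
-- unity of order dividing 2m.
open Complex in
theorem sum_exp_rieszNode_of_not_dvd {m : ℕ} (hm : m ≠ 0) {n : ℤ} (hn : ¬ (2 * m : ℤ) ∣ n) :
    ∑ r ∈ Finset.range (2 * m), exp (I * (n * rieszNode m r)) = 0 := by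
  have hmC : (m : ℂ) ≠ 0 := by exact_mod_cast hm
  have hz : ∀ r : ℕ, exp (I * (n * rieszNode m r)) =
      exp (I * (n * (Real.pi / (2 * m)))) * exp (2 * Real.pi * I * (n / (2 * m))) ^ r := by
    intro r
    rw [← exp_nat_mul, ← exp_add]
    congr 1
    simp only [rieszNode]
    push_cast
    field_simp
    ring
  have h1 : exp (2 * Real.pi * I * (n / (2 * m))) ≠ 1 := by
    intro h
    obtain ⟨q, hq⟩ := exp_eq_one_iff.1 h
    apply hn
    refine ⟨q, ?_⟩
    have h2 : (n : ℂ) / (2 * m) = q := by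
      have h3 : (2 * Real.pi * I : ℂ) ≠ 0 := two_pi_I_ne_zero
      apply mul_left_cancel₀ h3
      rw [hq]; ring
    rw [div_eq_iff (by simpa using hm)] at h2
    have h4 : (n : ℂ) = ((2 * m * q : ℤ) : ℂ) := by push_cast; rw [h2]; ring
    exact_mod_cast h4
  have h2 : exp (2 * Real.pi * I * (n / (2 * m))) ^ (2 * m) = 1 := by
    rw [← exp_nat_mul, exp_eq_one_iff]
    refine ⟨n, ?_⟩
    push_cast
    field_simp
  simp_rw [hz, ← Finset.mul_sum]
  rw [geom_sum_eq h1, h2]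
  simp

open Complex in
theorem sum_exp_rieszNode_zero (m : ℕ) :
    ∑ r ∈ Finset.range (2 * m), exp (I * ((0 : ℤ) * rieszNode m r)) = 2 * m := by
  simp

open Complex in
theorem sum_exp_rieszNode_two_mul {m : ℕ} (hm : m ≠ 0) :
    ∑ r ∈ Finset.range (2 * m), exp (I * ((2 * m : ℤ) * rieszNode m r)) = -(2 * m) := by
  have hmC : (m : ℂ) ≠ 0 := by exact_mod_cast hm
  have h : ∀ r : ℕ, exp (I * ((2 * m : ℤ) * rieszNode m r)) = -1 := by
    intro r
    have : I * ((2 * m : ℤ) * rieszNode m r) = r * (2 * Real.pi * I) + Real.pi * I := by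
      simp only [rieszNode]
      push_cast
      field_simp
    rw [this, exp_add, exp_pi_mul_I, exp_nat_mul_two_pi_mul_I]
    simp
  simp_rw [h]
  simp

open Complex in
theorem rieszFejer_eq_sum (m r : ℕ) :
    (rieszFejer m r : ℂ) = ∑ j ∈ Finset.range m, ∑ l ∈ Finset.range m,
      exp (I * (((j : ℤ) - l : ℤ) * rieszNode m r)) := by
  rw [rieszFejer]
  push_cast
  rw [← mul_conj', map_sum, Finset.sum_mul_sum]
  refine Finset.sum_congr rfl fun j _ => Finset.sum_congr rfl fun l _ => ?_
  rw [← exp_conj, ← exp_add]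
  congr 1
  simp
  ring

-- Only the diagonal survives the sum over nodes: off it, 0 < |j - l| < m, so 2m does not divide j -
-- l.
open Complex in
theorem sum_rieszFejer {m : ℕ} (hm : m ≠ 0) :
    ∑ r ∈ Finset.range (2 * m), rieszFejer m r = 2 * m ^ 2 := by
  have h : ∑ r ∈ Finset.range (2 * m), (rieszFejer m r : ℂ) = 2 * m ^ 2 := by
    simp_rw [rieszFejer_eq_sum]
    rw [Finset.sum_comm]
    have : ∀ j ∈ Finset.range m, ∑ r ∈ Finset.range (2 * m), ∑ l ∈ Finset.range m,
        exp (I * (((j : ℤ) - l : ℤ) * rieszNode m r)) = 2 * m := by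
      intro j hj
      rw [Finset.sum_comm, Finset.sum_eq_single j]
      · rw [sub_self]; exact sum_exp_rieszNode_zero m
      · intro l hl hlj
        apply sum_exp_rieszNode_of_not_dvd hm
        rintro ⟨q, hq⟩
        simp only [Finset.mem_range] at hj hl
        have hq0 : q = 0 := by
          by_contra h0
          rcases lt_or_gt_of_ne h0 with h | h
          · have : (2 * m : ℤ) * q ≤ 2 * m * (-1) := by gcongr; omega
            omega
          · have : (2 * m : ℤ) * 1 ≤ 2 * m * q := by gcongr; omega
            omega
        subst hq0
        omega
      · intro h; exact absurd hj h
    rw [Finset.sum_congr rfl this]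
    simp
    ring
  exact_mod_cast h

theorem rieszFejer_nonneg (m r : ℕ) : 0 ≤ rieszFejer m r := by
  unfold rieszFejer; positivity

theorem sum_abs_rieszWeight {m : ℕ} (hm : m ≠ 0) :
    ∑ r ∈ Finset.range (2 * m), |rieszWeight m r| = m := by
  have hmR : (m : ℝ) ≠ 0 := by exact_mod_cast hm
  have : ∀ r, |rieszWeight m r| = rieszFejer m r / (2 * m) := by
    intro r
    rw [rieszWeight, abs_div, abs_mul, abs_pow]
    simp [abs_of_nonneg (rieszFejer_nonneg m r)]
  simp_rw [this]
  rw [← Finset.sum_div, sum_rieszFejer hm]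
  field_simp

theorem sum_range_sum_range_ite_add_eq (m : ℕ) (n : ℤ) (hn : 0 ≤ n) (hnm : n ≤ m) (c : ℂ) :
    ∑ j ∈ Finset.range m, ∑ l ∈ Finset.range m, (if (l : ℤ) = j + n then c else 0) =
      (m - n : ℂ) * c := by
  lift n to ℕ using hn
  have hnm' : n ≤ m := by exact_mod_cast hnm
  have h : ∀ j ∈ Finset.range m, ∑ l ∈ Finset.range m, (if (l : ℤ) = j + n then c else 0) =
      if j < m - n then c else 0 := by
    intro j _
    have : ∀ l : ℕ, ((l : ℤ) = j + n) = (l = j + n) := by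
      intro l; apply propext; omega
    simp only [this, Finset.sum_ite_eq', Finset.mem_range]
    congr 1
    apply propext; omega
  rw [Finset.sum_congr rfl h, ← Finset.sum_filter, Finset.sum_const, nsmul_eq_mul]
  congr 1
  have : (Finset.range m).filter (fun j => j < m - n) = Finset.range (m - n) := by
    ext j; simp; omega
  rw [this, Finset.card_range]
  push_cast [hnm']
  rfl

open Complex in
theorem sum_exp_rieszNode {m : ℕ} (hm : m ≠ 0) {n : ℤ} (h1 : -(m : ℤ) < n) (h2 : n < 3 * m) :
    ∑ r ∈ Finset.range (2 * m), exp (I * (n * rieszNode m r)) =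
      (if n = 0 then (2 * m : ℂ) else 0) + (if n = 2 * m then -(2 * m : ℂ) else 0) := by
  by_cases h : (2 * m : ℤ) ∣ n
  · obtain ⟨q, rfl⟩ := h
    have hm' : (0 : ℤ) < m := by omega
    have hq : q = 0 ∨ q = 1 := by
      have : -1 < q := by nlinarith
      have : q < 2 := by nlinarith
      omega
    rcases hq with rfl | rfl
    · have := sum_exp_rieszNode_zero m
      rw [mul_zero, this]; simp [hm]
    · have := sum_exp_rieszNode_two_mul hm
      rw [mul_one, this]; simp [hm]
  · rw [sum_exp_rieszNode_of_not_dvd hm h]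
    have : n ≠ 0 := by rintro rfl; simp at h
    have : n ≠ 2 * m := by rintro rfl; simp at h
    simp [*]

-- This is the interpolation formula f' = ∑ w_r f(· + t_r) for f = exp(ikt), evaluated at 0.
-- Translation and linearity extend it to every trigonometric polynomial of degree at most m.
open Complex in
theorem sum_rieszWeight_mul_exp {m : ℕ} (hm : m ≠ 0) {k : ℤ} (hk : |k| ≤ m) :
    ∑ r ∈ Finset.range (2 * m), (rieszWeight m r : ℂ) * exp (I * (k * rieszNode m r)) = I * k := by
  have hmC : (m : ℂ) ≠ 0 := by exact_mod_cast hm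
  obtain ⟨hk1, hk2⟩ := abs_le.1 hk
  -- Since m t_r = π/2 + rπ, the alternating sign is itself a character of the node, and each
  -- weighted term becomes a sum of pure exponentials of frequency k + m + j - l.
  have hsign : ∀ r : ℕ, ((-1 : ℂ)) ^ r = -I * exp (I * (m * rieszNode m r)) := by
    intro r
    have : I * (m * rieszNode m r) = Real.pi / 2 * I + r * (Real.pi * I) := by
      simp only [rieszNode]
      push_cast
      field_simp
      ring
    rw [this, exp_add, exp_pi_div_two_mul_I, exp_nat_mul, exp_pi_mul_I]
    linear_combination ((-1 : ℂ) ^ r) * I_sq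
  have hterm : ∀ r : ℕ, (rieszWeight m r : ℂ) * exp (I * (k * rieszNode m r)) =
      (-I / (2 * m)) * ∑ j ∈ Finset.range m, ∑ l ∈ Finset.range m,
        exp (I * ((k + m + j - l : ℤ) * rieszNode m r)) := by
    intro r
    rw [rieszWeight]
    push_cast
    rw [rieszFejer_eq_sum, hsign]
    have : ∀ j l : ℕ, exp (I * (((k + m + j - l : ℤ) : ℂ) * rieszNode m r)) =
        exp (I * (m * rieszNode m r)) * exp (I * (k * rieszNode m r)) *
          exp (I * (((j : ℤ) - l : ℤ) * rieszNode m r)) := by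
      intro j l
      rw [← exp_add, ← exp_add]
      congr 1
      push_cast
      ring
    push_cast at this
    simp_rw [this, ← Finset.mul_sum]
    push_cast
    ring
  simp_rw [hterm, ← Finset.mul_sum]
  rw [Finset.sum_comm]
  have hinner : ∀ j ∈ Finset.range m, ∑ r ∈ Finset.range (2 * m), ∑ l ∈ Finset.range m,
      exp (I * ((k + m + j - l : ℤ) * rieszNode m r)) =
      ∑ l ∈ Finset.range m, ((if (l : ℤ) = j + (k + m) then (2 * m : ℂ) else 0) +
        (if (j : ℤ) = l + (m - k) then -(2 * m : ℂ) else 0)) := by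
    intro j hj
    rw [Finset.sum_comm]
    refine Finset.sum_congr rfl fun l hl => ?_
    simp only [Finset.mem_range] at hj hl
    rw [sum_exp_rieszNode hm (by omega) (by omega)]
    congr 1
    · congr 1; apply propext; omega
    · congr 1; apply propext; omega
  rw [Finset.sum_congr rfl hinner]
  simp_rw [Finset.sum_add_distrib]
  -- The frequencies lie strictly between -m and 3m, so only 0 and 2m contribute. Frequency 0 occurs
  -- for -k pairs when k ≤ 0, and frequency 2m for k pairs when k > 0.
  have hA : ∑ j ∈ Finset.range m, ∑ l ∈ Finset.range m,
      (if (l : ℤ) = j + (k + m) then (2 * m : ℂ) else 0) = (if k ≤ 0 then -(k : ℂ) * (2 * m) else 0) := by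
    split_ifs with h
    · rw [sum_range_sum_range_ite_add_eq m (k + m) (by omega) (by omega)]
      push_cast; ring
    · refine Finset.sum_eq_zero fun j hj => Finset.sum_eq_zero fun l hl => if_neg ?_
      simp only [Finset.mem_range] at hj hl
      omega
  have hB : ∑ j ∈ Finset.range m, ∑ l ∈ Finset.range m,
      (if (j : ℤ) = l + (m - k) then -(2 * m : ℂ) else 0) =
      (if k ≤ 0 then 0 else -(k : ℂ) * (2 * m)) := by
    rw [Finset.sum_comm]
    split_ifs with h
    · refine Finset.sum_eq_zero fun j hj => Finset.sum_eq_zero fun l hl => if_neg ?_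
      simp only [Finset.mem_range] at hj hl
      omega
    · rw [sum_range_sum_range_ite_add_eq m (m - k) (by omega) (by omega)]
      push_cast; ring
  rw [hA, hB]
  split_ifs <;> field_simp <;> ring

/-- The function `t ↦ ∑ᵣ wᵣ f (t + tᵣ)`, the derivative of a trigonometric polynomial `f` of degree
at most `m` by the interpolation formula of M. Riesz. -/
def rieszDeriv (m : ℕ) (f : ℝ → ℂ) (t : ℝ) : ℂ :=
  ∑ r ∈ Finset.range (2 * m), (rieszWeight m r : ℂ) * f (t + rieszNode m r)

theorem norm_rieszDeriv_le {m : ℕ} (hm : m ≠ 0) {f : ℝ → ℂ} {M : ℝ} (hf : ∀ t, ‖f t‖ ≤ M) (t : ℝ) :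
    ‖rieszDeriv m f t‖ ≤ m * M := by
  refine (norm_sum_le _ _).trans ?_
  rw [← sum_abs_rieszWeight hm, Finset.sum_mul]
  refine Finset.sum_le_sum fun r _ => ?_
  rw [norm_mul, Complex.norm_real, Real.norm_eq_abs]
  exact mul_le_mul_of_nonneg_left (hf _) (abs_nonneg _)

open Complex in
theorem hasDerivAt_exp_riesz {m : ℕ} (hm : m ≠ 0) {k : ℤ} (hk : |k| ≤ m) (t : ℝ) :
    HasDerivAt (fun t : ℝ => exp (I * (k * t)))
      (rieszDeriv m (fun t : ℝ => exp (I * (k * t))) t) t := by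
  have h : rieszDeriv m (fun t : ℝ => exp (I * (k * t))) t = exp (I * (k * t)) * (I * k) := by
    rw [← sum_rieszWeight_mul_exp hm hk, Finset.mul_sum]
    refine Finset.sum_congr rfl fun r _ => ?_
    have : exp (I * (k * ((t + rieszNode m r : ℝ) : ℂ))) =
        exp (I * (k * t)) * exp (I * (k * rieszNode m r)) := by
      rw [← exp_add]; congr 1; push_cast; ring
    simp only [this]; ring
  rw [h]
  have h1 : HasDerivAt (fun t : ℝ => I * (k * (t : ℂ))) (I * k) t := by
    have := ((Complex.ofRealCLM.hasDerivAt (x := t)).const_mul (k : ℂ)).const_mul I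
    simpa using this
  exact h1.cexp

/-! ### Bernstein bounds of first and second order in the variable arccos x -/

/-- The function `t ↦ ∑ₖ αₖ φₖ(cos t)`. -/
def chebTrig {m : ℕ} (α : Fin (m + 1) → ℂ) (t : ℝ) : ℂ :=
  chebSum α ⟨Real.cos t, Real.neg_one_le_cos t, Real.cos_le_one t⟩

theorem chebTrig_arccos {m : ℕ} (α : Fin (m + 1) → ℂ) (x : Dom) :
    chebTrig α (Real.arccos x) = chebSum α x := by
  unfold chebTrig
  congr 1
  exact Subtype.ext (Real.cos_arccos x.2.1 x.2.2)

open Complex in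
theorem exists_cheb_cos_eq (k : ℕ) : ∃ c : ℂ, ∀ t : ℝ,
    (cheb k ⟨Real.cos t, Real.neg_one_le_cos t, Real.cos_le_one t⟩ : ℂ) =
      c * (exp (I * ((k : ℤ) * t)) + exp (I * ((-k : ℤ) * t))) := by
  by_cases hk : k = 0
  · refine ⟨1 / 2, fun t => ?_⟩
    subst hk
    simp [cheb]
    norm_num
  · refine ⟨Real.sqrt 2 / 2, fun t => ?_⟩
    simp only [cheb, if_neg hk, Polynomial.Chebyshev.T_real_cos]
    push_cast
    rw [Complex.cos]
    have h1 : (k : ℂ) * t * I = I * (k * t) := by ring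
    have h2 : -((k : ℂ) * t) * I = I * (-k * t) := by ring
    rw [h1, h2]
    ring

theorem hasDerivAt_chebTrig {m : ℕ} (hm : m ≠ 0) (α : Fin (m + 1) → ℂ) (t : ℝ) :
    HasDerivAt (chebTrig α) (rieszDeriv m (chebTrig α) t) t := by
  choose c hc using exists_cheb_cos_eq
  have hf : chebTrig α = fun t : ℝ => ∑ k : Fin (m + 1), (α k * c k) *
      (Complex.exp (Complex.I * (((k : ℕ) : ℤ) * t)) +
        Complex.exp (Complex.I * ((-(k : ℕ) : ℤ) * t))) := by
    ext t
    unfold chebTrig chebSum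
    simp_rw [hc, mul_assoc]
  have hd : rieszDeriv m (chebTrig α) t = ∑ k : Fin (m + 1), (α k * c k) *
      (rieszDeriv m (fun t : ℝ => Complex.exp (Complex.I * (((k : ℕ) : ℤ) * t))) t +
        rieszDeriv m (fun t : ℝ => Complex.exp (Complex.I * ((-(k : ℕ) : ℤ) * t))) t) := by
    rw [hf]
    unfold rieszDeriv
    simp_rw [← Finset.sum_add_distrib, Finset.mul_sum]
    rw [Finset.sum_comm]
    refine Finset.sum_congr rfl fun k _ => Finset.sum_congr rfl fun r _ => ?_
    ring
  rw [hd, hf]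
  refine HasDerivAt.fun_sum fun k _ => ((HasDerivAt.add ?_ ?_).const_mul _)
  · exact hasDerivAt_exp_riesz hm (by have := k.2; rw [abs_le]; omega) t
  · exact hasDerivAt_exp_riesz hm (by have := k.2; rw [abs_le]; omega) t

/-- The Riesz operator is a finite combination of translations, so it commutes with differentiation
and the formula iterates to second derivatives. -/
theorem hasDerivAt_rieszDeriv {m : ℕ} {f : ℝ → ℂ}
    (hf : ∀ t, HasDerivAt f (rieszDeriv m f t) t) (t : ℝ) :
    HasDerivAt (rieszDeriv m f) (rieszDeriv m (rieszDeriv m f) t) t := by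
  refine HasDerivAt.fun_sum fun r _ => ((HasDerivAt.comp_add_const t _ ?_).const_mul _)
  exact hf _

/-- Bernstein's inequality, as a Lipschitz bound. -/
theorem norm_sub_le_of_hasDerivAt_riesz {m : ℕ} (hm : m ≠ 0) {f : ℝ → ℂ} {M : ℝ}
    (hf : ∀ t, HasDerivAt f (rieszDeriv m f t) t) (hM : ∀ t, ‖f t‖ ≤ M) (t s : ℝ) :
    ‖f t - f s‖ ≤ m * M * |t - s| :=
  Convex.norm_image_sub_le_of_norm_hasDerivWithin_le (s := Set.univ)
    (fun x _ => (hf x).hasDerivWithinAt) (fun x _ => norm_rieszDeriv_le hm hM x) convex_univ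
    (Set.mem_univ s) (Set.mem_univ t)

theorem norm_chebTrig_le {m : ℕ} {α : Fin (m + 1) → ℂ} (hα : ∀ x, ‖chebSum α x‖ ≤ 1) (t : ℝ) :
    ‖chebTrig α t‖ ≤ 1 := hα _

theorem norm_chebSum_sub_le {m : ℕ} (hm : m ≠ 0) {α : Fin (m + 1) → ℂ}
    (hα : ∀ x, ‖chebSum α x‖ ≤ 1) (x y : Dom) :
    ‖chebSum α x - chebSum α y‖ ≤ m * |Real.arccos x - Real.arccos y| := by
  rw [← chebTrig_arccos α x, ← chebTrig_arccos α y]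
  simpa using norm_sub_le_of_hasDerivAt_riesz hm (hasDerivAt_chebTrig hm α) (norm_chebTrig_le hα)
    (Real.arccos x) (Real.arccos y)

/-- Near a point of maximal modulus one, a bounded polynomial has modulus close to one. -/
theorem one_sub_sq_le_norm_chebSum {m : ℕ} (hm : m ≠ 0) {α : Fin (m + 1) → ℂ}
    (hα : ∀ x, ‖chebSum α x‖ ≤ 1) {y : Dom} (hy : ‖chebSum α y‖ = 1) (x : Dom) :
    1 - (m * |Real.arccos x - Real.arccos y|) ^ 2 ≤ ‖chebSum α x‖ := by
  set s := Real.arccos y with hs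
  set t := Real.arccos x with ht
  rw [← chebTrig_arccos α x, ← ht]
  rw [← chebTrig_arccos α y, ← hs] at hy
  set f := chebTrig α with hfdef
  have hf : ∀ t, HasDerivAt f (rieszDeriv m f t) t := hasDerivAt_chebTrig hm α
  have hb : ∀ t, ‖f t‖ ≤ 1 := norm_chebTrig_le hα
  -- Rotating by the conjugate of f(s) makes the real part of u f attain its maximum 1 at s. Its
  -- derivative vanishes there, and the second Bernstein bound gives quadratic decay.
  set u : ℂ := (starRingEnd ℂ) (f s) with hu
  have hu1 : ‖u‖ = 1 := by rw [hu, RCLike.norm_conj, hy]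
  have hus : u * f s = 1 := by rw [hu, mul_comm, Complex.mul_conj', hy]; simp
  have hg : ∀ t, HasDerivAt (fun t => (u * f t).re) (u * rieszDeriv m f t).re t := fun t =>
    Complex.reCLM.hasFDerivAt.comp_hasDerivAt t ((hf t).const_mul u)
  have hg1 : ∀ t, (u * f t).re ≤ 1 := fun t =>
    (Complex.re_le_norm _).trans (by rw [norm_mul, hu1, one_mul]; exact hb t)
  have hcrit : (u * rieszDeriv m f s).re = 0 := by
    refine IsLocalMax.hasDerivAt_eq_zero (Filter.Eventually.of_forall fun t => ?_) (hg s)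
    simp only [hus]
    simpa using hg1 t
  have hlip : ∀ z ∈ Set.uIcc s t, ‖(u * rieszDeriv m f z).re‖ ≤ m ^ 2 * |t - s| := by
    intro z hz
    have h1 := norm_sub_le_of_hasDerivAt_riesz hm (hasDerivAt_rieszDeriv hf)
      (fun t => norm_rieszDeriv_le hm hb t) z s
    have h2 : (u * rieszDeriv m f z).re = (u * (rieszDeriv m f z - rieszDeriv m f s)).re := by
      rw [mul_sub, Complex.sub_re, hcrit, sub_zero]
    rw [h2, Real.norm_eq_abs]
    refine (Complex.abs_re_le_norm _).trans ?_
    rw [norm_mul, hu1, one_mul]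
    refine h1.trans ?_
    have h3 : |z - s| ≤ |t - s| := Set.abs_sub_left_of_mem_uIcc hz
    calc (m : ℝ) * (m * 1) * |z - s| = m ^ 2 * |z - s| := by ring
      _ ≤ m ^ 2 * |t - s| := by gcongr
  have hmv := Convex.norm_image_sub_le_of_norm_hasDerivWithin_le (s := Set.uIcc s t)
    (fun x _ => (hg x).hasDerivWithinAt) hlip (convex_uIcc s t) Set.left_mem_uIcc
    Set.right_mem_uIcc
  simp only [hus, Complex.one_re] at hmv
  rw [Real.norm_eq_abs, Real.norm_eq_abs] at hmv
  have h4 : (u * f t).re ≤ ‖f t‖ :=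
    (Complex.re_le_norm _).trans (by rw [norm_mul, hu1, one_mul])
  have h5 := (abs_le.1 hmv).1
  have h6 : (m * |t - s|) ^ 2 = m ^ 2 * |t - s| * |t - s| := by ring
  linarith

theorem abs_arccos_sub_le {b x y : ℝ} (hb : b < 1) (hx : |x| ≤ b) (hy : |y| ≤ b) :
    |Real.arccos x - Real.arccos y| ≤ |x - y| / Real.sqrt (1 - b ^ 2) := by
  have hb0 : 0 ≤ b := (abs_nonneg x).trans hx
  have hpos : 0 < 1 - b ^ 2 := by nlinarith
  have h := Convex.norm_image_sub_le_of_norm_hasDerivWithin_le (f := Real.arccos)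
    (s := Set.Icc (-b) b) (C := 1 / Real.sqrt (1 - b ^ 2)) (f' := fun z => -(1 / √(1 - z ^ 2)))
    (x := y) (y := x)
    (fun z hz => (Real.hasDerivAt_arccos (by linarith [hz.1]) (by linarith [hz.2])).hasDerivWithinAt)
    (fun z hz => by
      rw [norm_neg, Real.norm_eq_abs, abs_of_nonneg (by positivity)]
      refine one_div_le_one_div_of_le (Real.sqrt_pos.2 hpos) (Real.sqrt_le_sqrt ?_)
      have := sq_le_sq' hz.1 hz.2
      linarith)
    (convex_Icc _ _) (abs_le.1 hy) (abs_le.1 hx)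
  rw [Real.norm_eq_abs, Real.norm_eq_abs] at h
  rwa [div_eq_mul_one_div, mul_comm]

/-! ### Orthogonality of the Chebyshev family and the coefficient bound -/

open Polynomial Polynomial.Chebyshev in
/-- The polynomial `φₖ`. -/
def chebPoly (k : ℕ) : ℝ[X] := if k = 0 then 1 else C (Real.sqrt 2) * T ℝ (k : ℤ)

theorem eval_chebPoly (k : ℕ) (x : Dom) : (chebPoly k).eval (x : ℝ) = cheb k x := by
  unfold chebPoly cheb
  split_ifs <;> simp

open Polynomial.Chebyshev in
theorem integral_chebPoly_mul (k l : ℕ) :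
    ∫ x, (chebPoly k).eval x * (chebPoly l).eval x ∂measureT =
      if k = l then Real.pi else 0 := by
  have h2 : Real.sqrt 2 * Real.sqrt 2 = 2 := Real.mul_self_sqrt (by norm_num)
  have key : ∀ k : ℕ, ∃ c : ℝ, ((k = 0 ∧ c = 1) ∨ (k ≠ 0 ∧ c = Real.sqrt 2)) ∧
      ∀ x : ℝ, (chebPoly k).eval x = c * (T ℝ (k : ℤ)).eval x := by
    intro k
    by_cases hk : k = 0
    · exact ⟨1, Or.inl ⟨hk, rfl⟩, fun x => by simp [chebPoly, hk]⟩
    · exact ⟨Real.sqrt 2, Or.inr ⟨hk, rfl⟩, fun x => by simp [chebPoly, hk]⟩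
  obtain ⟨c, hc, hck⟩ := key k
  obtain ⟨d, hd, hdl⟩ := key l
  have : ∀ x : ℝ, (chebPoly k).eval x * (chebPoly l).eval x =
      (c * d) * ((T ℝ (k : ℤ)).eval x * (T ℝ (l : ℤ)).eval x) := by
    intro x; rw [hck, hdl]; ring
  simp_rw [this]
  rw [integral_const_mul]
  split_ifs with h
  · subst h
    rcases hc with ⟨rfl, rfl⟩ | ⟨hk, rfl⟩
    · rcases hd with ⟨-, rfl⟩ | ⟨h0, -⟩
      · have := integral_eval_T_real_mul_self_measureT_zero
        simpa using this
      · exact absurd rfl h0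
    · rcases hd with ⟨h0, -⟩ | ⟨-, rfl⟩
      · exact absurd h0 hk
      · rw [h2, integral_T_real_mul_self_measureT_of_ne_zero hk]; ring
  · rw [integral_eval_T_real_mul_eval_T_real_measureT_of_ne h, mul_zero]

open Polynomial.Chebyshev in
theorem integral_sum_chebPoly_sq {m : ℕ} (a : Fin (m + 1) → ℝ) :
    ∫ x, (∑ k : Fin (m + 1), a k * (chebPoly k).eval x) ^ 2 ∂measureT =
      Real.pi * ∑ k, a k ^ 2 := by
  have hexp : ∀ x : ℝ, (∑ k : Fin (m + 1), a k * (chebPoly k).eval x) ^ 2 =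
      ∑ k : Fin (m + 1), ∑ l : Fin (m + 1),
        (a k * a l) * ((chebPoly k).eval x * (chebPoly l).eval x) := by
    intro x
    rw [sq, Finset.sum_mul_sum]
    refine Finset.sum_congr rfl fun k _ => Finset.sum_congr rfl fun l _ => ?_
    ring
  have hint : ∀ k l : Fin (m + 1), Integrable
      (fun x => (a k * a l) * ((chebPoly k).eval x * (chebPoly l).eval x)) measureT :=
    fun k l => integrable_measureT (by fun_prop)
  simp_rw [hexp]
  rw [integral_finsetSum _ fun k _ => integrable_finsetSum _ fun l _ => hint k l]
  simp_rw [integral_finsetSum _ fun l _ => hint _ l, integral_const_mul, integral_chebPoly_mul,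
    Fin.val_inj]
  simp [Finset.mul_sum]
  refine Finset.sum_congr rfl fun k _ => ?_
  ring

open Polynomial.Chebyshev in
/-- Bessel's inequality for the Chebyshev family: a polynomial bounded by one has coefficients
of Euclidean norm at most one. -/
theorem sum_norm_sq_le_one {m : ℕ} {α : Fin (m + 1) → ℂ} (hα : ∀ x, ‖chebSum α x‖ ≤ 1) :
    ∑ k, ‖α k‖ ^ 2 ≤ 1 := by
  have hre := integral_sum_chebPoly_sq fun k => (α k).re
  have him := integral_sum_chebPoly_sq fun k => (α k).im
  have hone : ∫ _, (1 : ℝ) ∂measureT = Real.pi := by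
    simpa using integral_eval_T_real_measureT_zero
  have hle : ∫ x, ((∑ k : Fin (m + 1), (α k).re * (chebPoly k).eval x) ^ 2 +
      (∑ k : Fin (m + 1), (α k).im * (chebPoly k).eval x) ^ 2) ∂measureT ≤
      ∫ _, (1 : ℝ) ∂measureT := by
    refine integral_mono_ae (integrable_measureT (by fun_prop)) (integrable_measureT (by fun_prop))
      ?_
    have hmem : ∀ᵐ x ∂measureT, x ∈ Set.Ioc (-1 : ℝ) 1 := by
      unfold measureT
      exact ae_restrict_mem measurableSet_Ioc
    filter_upwards [hmem] with x hx
    have h1 := hα ⟨x, hx.1.le, hx.2⟩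
    have h2 : chebSum α ⟨x, hx.1.le, hx.2⟩ =
        ⟨∑ k : Fin (m + 1), (α k).re * (chebPoly k).eval x,
          ∑ k : Fin (m + 1), (α k).im * (chebPoly k).eval x⟩ := by
      apply Complex.ext
      · simp [chebSum, ← eval_chebPoly]
      · simp [chebSum, ← eval_chebPoly]
    rw [h2] at h1
    have h3 := pow_le_one₀ (n := 2) (norm_nonneg _) h1
    rw [Complex.sq_norm, Complex.normSq_mk] at h3
    linarith [h3]
  rw [integral_add (integrable_measureT (by fun_prop)) (integrable_measureT (by fun_prop)),
    hre, him, hone, ← mul_add, ← Finset.sum_add_distrib] at hle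
  have : ∀ k, ‖α k‖ ^ 2 = (α k).re ^ 2 + (α k).im ^ 2 := by
    intro k; rw [Complex.sq_norm, Complex.normSq_apply]; ring
  simp_rw [this]
  exact le_of_mul_le_mul_left (by linarith) Real.pi_pos

/-! ### Gaussian tail of the noise -/

theorem measureReal_le_abs_of_gaussian {Ω : Type*} [MeasurableSpace Ω] {Pr : Measure Ω}
    [IsProbabilityMeasure Pr] {X : Ω → ℝ} {σ : ℝ}
    (hX : HasLaw X (gaussianReal 0 (σ ^ 2).toNNReal) Pr) {c : ℝ} (hc : 0 ≤ c) :
    Pr.real {ω | c ≤ |X ω|} ≤ 2 * Real.exp (-c ^ 2 / (2 * σ ^ 2)) := by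
  have hsub : HasSubgaussianMGF X (σ ^ 2).toNNReal Pr := by
    constructor
    · intro t
      have := integrable_exp_mul_gaussianReal (μ := 0) (v := (σ ^ 2).toNNReal) t
      rw [← hX.map_eq] at this
      exact this.comp_aemeasurable hX.aemeasurable
    · intro t
      rw [mgf_gaussianReal hX.map_eq]
      simp
  have hv : ((σ ^ 2).toNNReal : ℝ) = σ ^ 2 := Real.coe_toNNReal _ (sq_nonneg σ)
  have h1 := hsub.measure_ge_le hc
  have h2 := hsub.neg.measure_ge_le hc
  rw [hv] at h1 h2
  have hsubset : {ω | c ≤ |X ω|} ⊆ {ω | c ≤ X ω} ∪ {ω | c ≤ (-X) ω} := by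
    intro ω hω
    simp only [Set.mem_ofPred_eq] at hω
    exact le_abs.1 hω
  have h3 := (measureReal_mono hsubset (measure_ne_top Pr _)).trans (measureReal_union_le _ _)
  linarith

theorem measureReal_sum_sq_gaussian_le {Ω : Type*} [MeasurableSpace Ω] {Pr : Measure Ω}
    [IsProbabilityMeasure Pr] {m : ℕ} {σ : ℝ} {ε : Fin (m + 1) → Ω → ℝ}
    (hgauss : ∀ k, HasLaw (ε k) (gaussianReal 0 (σ ^ 2).toNNReal) Pr) {lam : ℝ} (hlam : 0 ≤ lam) :
    Pr.real {ω | lam ^ 2 < ∑ k, ε k ω ^ 2} ≤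
      2 * (m + 1) * Real.exp (-lam ^ 2 / (2 * σ ^ 2 * (m + 1))) := by
  -- If all m + 1 coordinates stay below this level, the squared norm is at most (m + 1)c² = λ².
  set c := lam / Real.sqrt (m + 1) with hc
  have hc0 : 0 ≤ c := by positivity
  have hcsq : c ^ 2 = lam ^ 2 / (m + 1) := by
    rw [hc, div_pow, Real.sq_sqrt (by positivity)]
  have hsubset : {ω | lam ^ 2 < ∑ k, ε k ω ^ 2} ⊆ ⋃ k, {ω | c ≤ |ε k ω|} := by
    intro ω hω
    simp only [Set.mem_ofPred_eq] at hω
    by_contra h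
    simp only [Set.mem_iUnion, Set.mem_ofPred_eq, not_exists, not_le] at h
    have : ∑ k, ε k ω ^ 2 ≤ ∑ _k : Fin (m + 1), c ^ 2 := by
      refine Finset.sum_le_sum fun k _ => ?_
      rw [← sq_abs]
      exact pow_le_pow_left₀ (abs_nonneg _) (h k).le 2
    rw [Finset.sum_const, Finset.card_univ, Fintype.card_fin, nsmul_eq_mul, hcsq] at this
    push_cast at this
    rw [mul_div_cancel₀ _ (by positivity)] at this
    linarith
  refine (measureReal_mono hsubset (measure_ne_top Pr _)).trans ?_
  refine (measureReal_iUnion_fintype_le _).trans ?_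
  refine (Finset.sum_le_sum fun k _ => measureReal_le_abs_of_gaussian (hgauss k) hc0).trans ?_
  rw [Finset.sum_const, Finset.card_univ, Fintype.card_fin, nsmul_eq_mul, hcsq]
  apply le_of_eq
  push_cast
  have : -(lam ^ 2 / ((m : ℝ) + 1)) / (2 * σ ^ 2) = -lam ^ 2 / (2 * σ ^ 2 * (m + 1)) := by
    rw [← neg_div, div_div]; ring
  rw [this]
  ring

theorem lamM_pos {m : ℕ} (hm : 9 ≤ m) {σ : ℝ} (hσ : 0 < σ) : 0 < lamM m σ := by
  have h : (1 : ℝ) < m := by exact_mod_cast (by omega : 1 < m)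
  have := Real.log_pos h
  unfold lamM
  positivity

theorem noise_bound_lt {m : ℕ} (hm : 9 ≤ m) {σ : ℝ} (hσ : 0 < σ) {lam : ℝ}
    (hlam : lamM m σ ≤ lam) :
    2 * (m + 1) * Real.exp (-lam ^ 2 / (2 * σ ^ 2 * (m + 1))) <
      8 * Real.sqrt 6 / Real.sqrt (2 * Real.pi) * (lam / lamM m σ) * Real.sqrt (Real.log m) *
        Real.exp (-((2 * (lam ^ 2 / lamM m σ ^ 2) - 1) * Real.log m)) := by
  have hpos := lamM_pos hm hσ
  have hmR : (9 : ℝ) ≤ m := by exact_mod_cast hm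
  have hℓ : 1 ≤ Real.log m := by
    rw [Real.le_log_iff_exp_le (by linarith)]
    linarith [Real.exp_one_lt_d9]
  set ℓ := Real.log m with hℓdef
  set q := lam / lamM m σ with hq
  have hq1 : 1 ≤ q := by rwa [hq, one_le_div hpos]
  have hlamq : lam = q * lamM m σ := by rw [hq, div_mul_cancel₀ _ hpos.ne']
  have hMsq : lamM m σ ^ 2 = σ ^ 2 * (6 * m * ℓ) := by
    unfold lamM
    rw [mul_pow, Real.sq_sqrt (by positivity)]
  have hq2 : lam ^ 2 / lamM m σ ^ 2 = q ^ 2 := by rw [hq, div_pow]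
  -- With λ = qλ_M the exponent is -3q² m log m / (m + 1), and 3m ≥ 2(m + 1).
  have hexp1 : -lam ^ 2 / (2 * σ ^ 2 * (m + 1)) ≤ -(2 * q ^ 2 * ℓ) := by
    rw [hlamq, mul_pow, hMsq, neg_div, neg_le_neg_iff, le_div_iff₀ (by positivity)]
    have : 0 ≤ q ^ 2 * σ ^ 2 * ℓ := by positivity
    nlinarith
  have hexp2 : Real.exp (-((2 * q ^ 2 - 1) * ℓ)) = m * Real.exp (-(2 * q ^ 2 * ℓ)) := by
    have : -((2 * q ^ 2 - 1) * ℓ) = ℓ + -(2 * q ^ 2 * ℓ) := by ring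
    rw [this, Real.exp_add, hℓdef, Real.exp_log (by linarith)]
  have hsqrtℓ : 1 ≤ Real.sqrt ℓ := Real.one_le_sqrt.2 hℓ
  have hconst : 3 ≤ 8 * Real.sqrt 6 / Real.sqrt (2 * Real.pi) := by
    rw [le_div_iff₀ (Real.sqrt_pos.2 (by positivity))]
    have h1 : Real.sqrt (2 * Real.pi) ≤ Real.sqrt 9 :=
      Real.sqrt_le_sqrt (by linarith [Real.pi_lt_four])
    have h2 : Real.sqrt 9 = 3 := by
      rw [show (9 : ℝ) = 3 ^ 2 by norm_num]; exact Real.sqrt_sq (by norm_num)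
    have h3 : (2 : ℝ) ≤ Real.sqrt 6 := Real.le_sqrt_of_sq_le (by norm_num)
    linarith
  rw [hq2, hexp2]
  have hE : 0 < Real.exp (-(2 * q ^ 2 * ℓ)) := Real.exp_pos _
  calc 2 * ((m : ℝ) + 1) * Real.exp (-lam ^ 2 / (2 * σ ^ 2 * (m + 1)))
      ≤ 2 * (m + 1) * Real.exp (-(2 * q ^ 2 * ℓ)) := by gcongr
    -- Here 2(m + 1) < 3m; the three factors of the product are lower bounds for the numerical
    -- constant, for q and for √(log m).
    _ < (3 * 1 * 1) * (m * Real.exp (-(2 * q ^ 2 * ℓ))) := by nlinarith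
    _ ≤ _ := by gcongr

/-- With the stated probability, the Euclidean norm of the noise is at most `lam`. -/
theorem exists_noise_event {Ω : Type*} [MeasurableSpace Ω] (Pr : Measure Ω)
    [IsProbabilityMeasure Pr] {m : ℕ} (hm : 9 ≤ m) {σ : ℝ} (hσ : 0 < σ) {ε : Fin (m + 1) → Ω → ℝ}
    (hgauss : ∀ k, HasLaw (ε k) (gaussianReal 0 (σ ^ 2).toNNReal) Pr) {lam : ℝ}
    (hlam : lamM m σ ≤ lam) :
    ∃ E : Set Ω, MeasurableSet E ∧
      1 - 8 * Real.sqrt 6 / Real.sqrt (2 * Real.pi) * (lam / lamM m σ) *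
          Real.sqrt (Real.log m) *
          Real.exp (-((2 * (lam ^ 2 / lamM m σ ^ 2) - 1) * Real.log m)) < Pr.real E ∧
      ∀ ω ∈ E, ∑ k, ε k ω ^ 2 ≤ lam ^ 2 := by
  set bad := {ω | lam ^ 2 < ∑ k, ε k ω ^ 2} with hbad
  -- The noise is only almost everywhere measurable, so the bad event is replaced by a measurable
  -- hull of the same measure.
  refine ⟨(toMeasurable Pr bad)ᶜ, (measurableSet_toMeasurable _ _).compl, ?_, ?_⟩
  · have h1 := measureReal_sum_sq_gaussian_le hgauss ((lamM_pos hm hσ).le.trans hlam)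
    have h2 := noise_bound_lt hm hσ hlam
    rw [probReal_compl_eq_one_sub (measurableSet_toMeasurable _ _), measureReal_def,
      measure_toMeasurable, ← measureReal_def]
    linarith
  · intro ω hω
    by_contra h
    exact hω (subset_toMeasurable _ _ (not_le.1 h))

/-! ### Optimality of a solution and the defect of a dual polynomial -/

theorem tvNorm_convexCombination_le (μ ν : ComplexMeasure Dom) {t : ℝ} (h0 : 0 ≤ t) (h1 : t ≤ 1) :
    tvNorm ((1 - t) • μ + t • ν) ≤ (1 - t) * tvNorm μ + t * tvNorm ν := by
  refine (tvNorm_add_le _ _).trans ?_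
  rw [tvNorm_smul, tvNorm_smul, abs_of_nonneg h0, abs_of_nonneg (by linarith)]

/-- First-order optimality of a solution, tested in the direction of the target measure `ν`. -/
theorem IsSolution.mul_tvNorm_sub_le {m : ℕ} {lam : ℝ} (hlam : 0 ≤ lam) {e : Fin (m + 1) → ℝ}
    {μ ν : ComplexMeasure Dom}
    (h : IsSolution m lam (fun k => moment k ν + (e k : ℂ)) μ) :
    lam * (tvNorm μ - tvNorm ν) ≤
      ∑ k : Fin (m + 1), e k * (moment k μ - moment k ν).re -
        ∑ k : Fin (m + 1), ‖moment k μ - moment k ν‖ ^ 2 := by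
  set N := ∑ k : Fin (m + 1), ‖moment k μ - moment k ν‖ ^ 2 with hN
  set S := ∑ k : Fin (m + 1), e k * (moment k μ - moment k ν).re with hS
  have key : ∀ t : ℝ, 0 < t → t ≤ 1 → lam * (tvNorm μ - tvNorm ν) ≤ S - N + t / 2 * N := by
    intro t ht0 ht1
    have hJ := h ((1 - t) • μ + t • ν)
    unfold objective at hJ
    have htv := mul_le_mul_of_nonneg_left (tvNorm_convexCombination_le μ ν ht0.le ht1) hlam
    have hterm : ∀ k : Fin (m + 1),
        ‖moment k ((1 - t) • μ + t • ν) - (moment k ν + (e k : ℂ))‖ ^ 2 =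
        ‖moment k μ - (moment k ν + (e k : ℂ))‖ ^ 2 + 2 * t * (e k * (moment k μ - moment k ν).re)
          - (2 * t - t ^ 2) * ‖moment k μ - moment k ν‖ ^ 2 := by
      intro k
      rw [moment_add, moment_smul, moment_smul]
      simp only [Complex.sq_norm, Complex.normSq_apply]
      simp
      ring
    simp_rw [hterm] at hJ
    rw [Finset.sum_sub_distrib, Finset.sum_add_distrib, ← Finset.mul_sum, ← Finset.mul_sum,
      ← hN, ← hS] at hJ
    have h2 : t * (lam * (tvNorm μ - tvNorm ν)) ≤ t * (S - N + t / 2 * N) := by linarith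
    exact le_of_mul_le_mul_left h2 ht0
  have hN0 : 0 ≤ N := Finset.sum_nonneg fun k _ => by positivity
  -- Letting t tend to 0 removes the second order term; N + 1 avoids dividing by zero.
  refine le_of_forall_pos_le_add fun δ hδ => ?_
  have ht : 0 < min 1 (δ / (N + 1)) := lt_min one_pos (by positivity)
  refine (key _ ht (min_le_left _ _)).trans ?_
  have h3 : min 1 (δ / (N + 1)) * (N + 1) ≤ δ := by
    rw [← le_div_iff₀ (by positivity)]; exact min_le_right _ _
  nlinarith

theorem sum_mul_le_mul_sqrt {ι : Type*} (t : Finset ι) {f g : ι → ℝ} {c : ℝ} (hc : 0 ≤ c)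
    (hf : ∑ k ∈ t, f k ^ 2 ≤ c ^ 2) :
    ∑ k ∈ t, f k * g k ≤ c * Real.sqrt (∑ k ∈ t, g k ^ 2) := by
  refine (Real.sum_mul_le_sqrt_mul_sqrt t f g).trans ?_
  gcongr
  exact Real.sqrt_le_iff.2 ⟨hc, hf⟩

theorem norm_sum_mul_le_sqrt {ι : Type*} (t : Finset ι) {f g : ι → ℂ}
    (hf : ∑ k ∈ t, ‖f k‖ ^ 2 ≤ 1) :
    ‖∑ k ∈ t, f k * g k‖ ≤ Real.sqrt (∑ k ∈ t, ‖g k‖ ^ 2) := by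
  refine (norm_sum_le _ _).trans ?_
  simp_rw [norm_mul]
  simpa using sum_mul_le_mul_sqrt t (f := fun k => ‖f k‖) (g := fun k => ‖g k‖) zero_le_one
    (by simpa using hf)

/-- The defect `‖μ‖ - Re ∫ P dμ` of a solution with respect to a dual certificate `P`. -/
theorem IsSolution.mul_defect_le {m : ℕ} {lam : ℝ} (hlam : 0 ≤ lam) {e : Fin (m + 1) → ℝ}
    (he : ∑ k, e k ^ 2 ≤ lam ^ 2) {μ ν : ComplexMeasure Dom}
    (h : IsSolution m lam (fun k => moment k ν + (e k : ℂ)) μ) {α : Fin (m + 1) → ℂ}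
    (hα : ∑ k, ‖α k‖ ^ 2 ≤ 1)
    (hν : tvNorm ν ≤ (∑ k : Fin (m + 1), α k * moment k ν).re) :
    lam * (tvNorm μ - (∑ k : Fin (m + 1), α k * moment k μ).re) ≤
      2 * lam * Real.sqrt (∑ k : Fin (m + 1), ‖moment k μ - moment k ν‖ ^ 2) -
        Real.sqrt (∑ k : Fin (m + 1), ‖moment k μ - moment k ν‖ ^ 2) ^ 2 := by
  have h1 := h.mul_tvNorm_sub_le hlam
  set N := Real.sqrt (∑ k : Fin (m + 1), ‖moment k μ - moment k ν‖ ^ 2) with hN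
  have hNsq : ∑ k : Fin (m + 1), ‖moment k μ - moment k ν‖ ^ 2 = N ^ 2 :=
    (Real.sq_sqrt (Finset.sum_nonneg fun k _ => by positivity)).symm
  rw [hNsq] at h1
  have h2 : ∑ k : Fin (m + 1), e k * (moment k μ - moment k ν).re ≤ lam * N := by
    have h3 : ∑ k : Fin (m + 1), e k * (moment k μ - moment k ν).re ≤
        ∑ k : Fin (m + 1), |e k| * ‖moment k μ - moment k ν‖ := by
      refine Finset.sum_le_sum fun k _ => (le_abs_self _).trans ?_
      rw [abs_mul]
      gcongr
      exact Complex.abs_re_le_norm _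
    exact h3.trans (sum_mul_le_mul_sqrt _ hlam (by simpa using he))
  have h4 : ‖∑ k : Fin (m + 1), α k * (moment k μ - moment k ν)‖ ≤ N :=
    norm_sum_mul_le_sqrt _ hα
  have h5 : (∑ k : Fin (m + 1), α k * moment k μ).re = (∑ k : Fin (m + 1), α k * moment k ν).re +
      (∑ k : Fin (m + 1), α k * (moment k μ - moment k ν)).re := by
    simp_rw [mul_sub, Finset.sum_sub_distrib, Complex.sub_re]
    ring
  have h6 : -N ≤ (∑ k : Fin (m + 1), α k * (moment k μ - moment k ν)).re :=
    (neg_le_neg h4).trans (neg_le_of_abs_le (Complex.abs_re_le_norm _))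
  have h7 : tvNorm μ - (∑ k : Fin (m + 1), α k * moment k μ).re ≤ tvNorm μ - tvNorm ν + N := by
    linarith
  have h8 := mul_le_mul_of_nonneg_left h7 hlam
  linarith

theorem integral_one_sub_norm_le_defect {m : ℕ} (α : Fin (m + 1) → ℂ) (μ : ComplexMeasure Dom) :
    ∫ x, (1 - ‖chebSum α x‖) ∂μ.variation ≤
      tvNorm μ - (∑ k : Fin (m + 1), α k * moment k μ).re := by
  rw [integral_sub (integrable_const _) (integrable_of_continuous (by fun_prop))]
  have h1 := (Complex.re_le_norm _).trans (norm_sum_mul_moment_le α μ)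
  have h2 : ∫ _, (1 : ℝ) ∂μ.variation = tvNorm μ := by simp [tvNorm]
  linarith

theorem norm_singleton_mul_le_defect {m : ℕ} {α : Fin (m + 1) → ℂ}
    (hα : ∀ x, ‖chebSum α x‖ ≤ 1) (μ : ComplexMeasure Dom) (x : Dom) :
    ‖μ {x}‖ * (1 - ‖chebSum α x‖) ≤
      tvNorm μ - (∑ k : Fin (m + 1), α k * moment k μ).re := by
  refine le_trans ?_ (integral_one_sub_norm_le_defect α μ)
  have h1 : ∫ y in {x}, (1 - ‖chebSum α y‖) ∂μ.variation ≤
      ∫ y, (1 - ‖chebSum α y‖) ∂μ.variation :=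
    setIntegral_le_integral (integrable_of_continuous (by fun_prop))
      (Filter.Eventually.of_forall fun y => sub_nonneg.2 (hα y))
  rw [integral_singleton, smul_eq_mul] at h1
  refine le_trans ?_ h1
  exact mul_le_mul_of_nonneg_right VectorMeasure.norm_measure_le_variation (sub_nonneg.2 (hα x))

/-- The variation measure is concentrated on its support, so a bound on the modulus there is enough.
-/
theorem re_sum_mul_moment_le_of_supp {m : ℕ} (α : Fin (m + 1) → ℂ) (μ : ComplexMeasure Dom)
    {L : ℝ} (hL : ∀ x ∈ supp μ, ‖chebSum α x‖ ≤ L) :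
    (∑ k : Fin (m + 1), α k * moment k μ).re ≤ L * tvNorm μ := by
  refine ((Complex.re_le_norm _).trans (norm_sum_mul_moment_le α μ)).trans ?_
  have h1 : ∫ x, ‖chebSum α x‖ ∂μ.variation ≤ ∫ _, L ∂μ.variation := by
    refine integral_mono_ae (integrable_of_continuous (by fun_prop)) (integrable_const _) ?_
    filter_upwards [Measure.support_mem_ae (μ := μ.variation)] with x hx using hL x hx
  refine h1.trans (le_of_eq ?_)
  simp [tvNorm, mul_comm]

theorem chebSum_mul_sub {m : ℕ} (α β : Fin (m + 1) → ℂ) (c : ℂ) (x : Dom) :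
    chebSum (fun k => c * α k - β k) x = c * chebSum α x - chebSum β x := by
  simp only [chebSum, Finset.mul_sum, ← Finset.sum_sub_distrib]
  exact Finset.sum_congr rfl fun k _ => by ring

/-! ### Dual certificates: separation and size constraints forced by QIC -/

/-- A dual certificate for the phases `θ` at the points `T`, as provided by `QIC`. -/
structure IsCertificate {m s : ℕ} (T : Fin s → Dom) (Ca Cb : ℝ) (θ : Fin s → ℝ)
    (α : Fin (m + 1) → ℂ) : Prop where
  interpolates : ∀ k, chebSum α (T k) = Complex.exp (-(Complex.I * (θ k : ℂ)))
  isolates : ∀ x : Dom,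
    (⨅ k, min (Ca * (m : ℝ) ^ 2 * dist x (T k) ^ 2) Cb) ≤ 1 - ‖chebSum α x‖

section Certificate

variable {m s : ℕ} {T : Fin s → Dom} {Ca Cb c₀ : ℝ} {θ : Fin s → ℝ} {α β : Fin (m + 1) → ℂ}

theorem QIC.exists_isCertificate (h : QIC m T Ca Cb) (θ : Fin s → ℝ) :
    ∃ α : Fin (m + 1) → ℂ, IsCertificate T Ca Cb θ α := by
  obtain ⟨-, -, -, h⟩ := h
  obtain ⟨P, hP, h1, h2⟩ := h θ
  obtain ⟨α, rfl⟩ := exists_chebSum_of_mem_chebSpan hP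
  exact ⟨α, h1, h2⟩

theorem IsCertificate.norm_le_one (h : IsCertificate T Ca Cb θ α) (hCa : 0 < Ca) (hCb : 0 < Cb)
    (x : Dom) : ‖chebSum α x‖ ≤ 1 := by
  have h1 : 0 ≤ ⨅ k, min (Ca * (m : ℝ) ^ 2 * dist x (T k) ^ 2) Cb :=
    Real.iInf_nonneg fun k => le_min (by positivity) hCb.le
  linarith [h.isolates x]

theorem IsCertificate.norm_eq_one (h : IsCertificate T Ca Cb θ α) (k : Fin s) :
    ‖chebSum α (T k)‖ = 1 := by
  rw [h.interpolates, mul_comm, ← neg_mul, ← Complex.ofReal_neg, Complex.norm_exp_ofReal_mul_I]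

theorem exists_min_le_iInf (x : Dom) (j : Fin s) :
    ∃ k, min (Ca * (m : ℝ) ^ 2 * dist x (T k) ^ 2) Cb ≤
      ⨅ k, min (Ca * (m : ℝ) ^ 2 * dist x (T k) ^ 2) Cb := by
  have : Nonempty (Fin s) := ⟨j⟩
  obtain ⟨k, hk⟩ := exists_eq_ciInf_of_finite
    (f := fun k => min (Ca * (m : ℝ) ^ 2 * dist x (T k) ^ 2) Cb)
  exact ⟨k, hk.le⟩

theorem IsCertificate.re_sum_mul_moment_spikes (h : IsCertificate T Ca Cb θ α) (a : Fin s → ℝ) :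
    ∑ k : Fin (m + 1), α k * moment k (spikes T a θ) = ((∑ j, a j : ℝ) : ℂ) := by
  rw [sum_mul_moment_spikes, Complex.ofReal_sum]
  refine Finset.sum_congr rfl fun j _ => ?_
  rw [h.interpolates, mul_left_comm, ← Complex.exp_add, neg_add_cancel, Complex.exp_zero, mul_one]

theorem abs_le_of_edge {t : Dom}
    (h : 2 * c₀ ≤ |(t : ℝ) - 1| ∧ 2 * c₀ ≤ |(t : ℝ) - (-1)|) : |(t : ℝ)| ≤ 1 - 2 * c₀ := by
  obtain ⟨h1, h2⟩ := h
  have ht := t.2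
  rw [abs_of_nonpos (by linarith [ht.2])] at h1
  rw [abs_of_nonneg (by linarith [ht.1])] at h2
  rw [abs_le]
  constructor <;> linarith

theorem three_mul_sq_mul_arccos_sub_sq_le {x y : ℝ} (hc₀ : 0 < c₀) (hc₁ : c₀ ≤ 1 / 2)
    (hx : |x| ≤ 1 - 3 / 2 * c₀) (hy : |y| ≤ 1 - 3 / 2 * c₀) :
    3 * c₀ ^ 2 * |Real.arccos x - Real.arccos y| ^ 2 ≤ |x - y| ^ 2 := by
  have h := abs_arccos_sub_le (by linarith) hx hy
  -- Staying 3c₀/2 away from the endpoints bounds the derivative of arccos by 1/(√3 c₀). The factor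
  -- 3/2, rather than 2, leaves room for points within c₀/m ≤ c₀/2 of a spike.
  have hpos : 3 * c₀ ^ 2 ≤ 1 - (1 - 3 / 2 * c₀) ^ 2 := by nlinarith
  have hpos' : 0 < 1 - (1 - 3 / 2 * c₀) ^ 2 := lt_of_lt_of_le (by positivity) hpos
  have h2 := pow_le_pow_left₀ (abs_nonneg _) h 2
  rw [div_pow, Real.sq_sqrt hpos'.le, le_div_iff₀ hpos'] at h2
  nlinarith [sq_nonneg |Real.arccos x - Real.arccos y|]

/-- Two distinct points of a set satisfying `QIC` are at distance at least `2 c₀ / m`. -/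
theorem QIC.separation (hm : m ≠ 0) (h : QIC m T Ca Cb) (hc₀ : 0 < c₀)
    (hedge : ∀ j, 2 * c₀ ≤ |(T j : ℝ) - 1| ∧ 2 * c₀ ≤ |(T j : ℝ) - (-1)|) {i j : Fin s}
    (hij : i ≠ j) : 2 * c₀ / m ≤ |(T i : ℝ) - T j| := by
  -- The phases 0 and π force a jump of 2 between the two points.
  obtain ⟨α, hα⟩ := h.exists_isCertificate fun k => if k = j then Real.pi else 0
  have hi : chebSum α (T i) = 1 := by rw [hα.interpolates]; simp [hij]
  have hj : chebSum α (T j) = -1 := by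
    rw [hα.interpolates, Complex.exp_neg]
    simp [mul_comm Complex.I, Complex.exp_pi_mul_I]
  have hei := abs_le_of_edge (hedge i)
  have hej := abs_le_of_edge (hedge j)
  have hc₁ : c₀ ≤ 1 / 2 := by linarith [abs_nonneg (T i : ℝ)]
  have h1 := norm_chebSum_sub_le hm (hα.norm_le_one h.1 h.2.1) (T i) (T j)
  rw [hi, hj] at h1
  have h1' : (2 : ℝ) ≤ m * |Real.arccos (T i) - Real.arccos (T j)| := by
    refine le_trans (le_of_eq ?_) h1
    norm_num
  have h2 := three_mul_sq_mul_arccos_sub_sq_le hc₀ hc₁ (by linarith : |(T i : ℝ)| ≤ _)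
    (by linarith : |(T j : ℝ)| ≤ _)
  have hm0 : (0 : ℝ) < m := by positivity
  rw [div_le_iff₀ hm0]
  apply le_of_sq_le_sq _ (by positivity)
  have h3 := pow_le_pow_left₀ (by norm_num) h1' 2
  rw [mul_pow] at h3 ⊢
  rw [mul_pow]
  calc 2 ^ 2 * c₀ ^ 2 ≤ (m ^ 2 * |Real.arccos (T i) - Real.arccos (T j)| ^ 2) * c₀ ^ 2 := by gcongr
    _ = m ^ 2 * (c₀ ^ 2 * |Real.arccos (T i) - Real.arccos (T j)| ^ 2) := by ring
    _ ≤ m ^ 2 * |(T i : ℝ) - T j| ^ 2 := by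
        gcongr
        nlinarith [sq_nonneg (c₀ * |Real.arccos (T i) - Real.arccos (T j)|)]
    _ = |(T i : ℝ) - T j| ^ 2 * m ^ 2 := by ring

/-- Within `c₀ / m` of a point of the set, arccosine distances are controlled. -/
theorem three_mul_sq_mul_arccos_sub_sq_le_of_near (hm : 2 ≤ m) {t x : Dom} (hc₀ : 0 < c₀)
    (ht : |(t : ℝ)| ≤ 1 - 2 * c₀) (hx : |(x : ℝ) - t| ≤ c₀ / m) :
    3 * c₀ ^ 2 * |Real.arccos x - Real.arccos t| ^ 2 ≤ |(x : ℝ) - t| ^ 2 := by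
  have hmR : (2 : ℝ) ≤ m := by exact_mod_cast hm
  have h1 : c₀ / m ≤ c₀ / 2 := by gcongr
  have h2 : |(x : ℝ)| ≤ |(x : ℝ) - t| + |(t : ℝ)| := by
    simpa using abs_add_le ((x : ℝ) - t) t
  refine three_mul_sq_mul_arccos_sub_sq_le hc₀ ?_ ?_ ?_
  · linarith [abs_nonneg (t : ℝ)]
  · linarith
  · linarith

theorem abs_sub_le_of_mul_sq_le (hm : m ≠ 0) (hc₀ : 0 < c₀) (hCa : 0 < Ca)
    (hC : Cb / Ca ≤ c₀ ^ 2) {d : ℝ} (hd : Ca * m ^ 2 * d ^ 2 ≤ Cb) : d ≤ c₀ / m := by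
  have hm0 : (0 : ℝ) < m := by positivity
  rw [le_div_iff₀ hm0]
  apply le_of_sq_le_sq _ hc₀.le
  refine le_trans ?_ hC
  rw [le_div_iff₀ hCa]
  linarith

/-- QIC asks a certificate to drop by C_b at distance √(C_b/C_a)/m from a spike, but the second
order Bernstein bound allows a drop of at most 1/3 there. This bound makes L at least 8 later on. -/
theorem QIC.le_third (hm : 2 ≤ m) (h : QIC m T Ca Cb) (hc₀ : 0 < c₀)
    (hedge : ∀ j, 2 * c₀ ≤ |(T j : ℝ) - 1| ∧ 2 * c₀ ≤ |(T j : ℝ) - (-1)|)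
    (hC : Cb / Ca ≤ c₀ ^ 2) (j : Fin s) : Cb ≤ 1 / 3 := by
  obtain ⟨hCa, hCb, -, -⟩ := id h
  obtain ⟨α, hα⟩ := h.exists_isCertificate fun _ => 0
  have hm0 : (0 : ℝ) < m := by positivity
  have hej := abs_le_of_edge (hedge j)
  -- This is the distance at which the two branches of the QIC minimum meet. As d ≤ c₀/m, separation
  -- keeps every other spike at least as far from the test point.
  set d := Real.sqrt (Cb / Ca) / m with hd
  have hd0 : 0 ≤ d := by positivity
  have hdsq : Ca * m ^ 2 * d ^ 2 = Cb := by
    rw [hd, div_pow, Real.sq_sqrt (by positivity)]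
    field_simp
  have hdle : d ≤ c₀ / m := abs_sub_le_of_mul_sq_le (by omega) hc₀ hCa hC hdsq.le
  have hdle' : c₀ / m ≤ c₀ := div_le_self hc₀.le (by exact_mod_cast (by omega : 1 ≤ m))
  have hejb := abs_le.1 hej
  set x : Dom := ⟨T j + d, by linarith [hejb.1], by linarith [hejb.2]⟩ with hx
  have hxj : |(x : ℝ) - T j| = d := by rw [hx]; simp [abs_of_nonneg hd0]
  have hfar : ∀ k, d ≤ |(x : ℝ) - T k| := by
    intro k
    by_cases hk : k = j
    · rw [hk, hxj]
    · have h1 := h.separation (by omega) hc₀ hedge hk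
      have h2 : |(T k : ℝ) - T j| ≤ |(x : ℝ) - T k| + |(x : ℝ) - T j| := by
        rw [abs_sub_comm (x : ℝ) (T k)]
        exact abs_sub_le _ _ _
      have h3 : 2 * c₀ / m = 2 * (c₀ / m) := by ring
      linarith
  have hinf : Cb ≤ ⨅ k, min (Ca * (m : ℝ) ^ 2 * dist x (T k) ^ 2) Cb := by
    have : Nonempty (Fin s) := ⟨j⟩
    refine le_ciInf fun k => le_min ?_ le_rfl
    rw [Subtype.dist_eq, Real.dist_eq]
    rw [← hdsq]
    have := hfar k
    gcongr
  have h1 := hinf.trans (hα.isolates x)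
  have h2 := one_sub_sq_le_norm_chebSum (by omega) (hα.norm_le_one hCa hCb) (hα.norm_eq_one j) x
  have h3 := three_mul_sq_mul_arccos_sub_sq_le_of_near hm hc₀ hej (hxj.trans_le hdle)
  rw [hxj] at h3
  rw [mul_pow] at h2
  set τ := |Real.arccos x - Real.arccos (T j)| with hτ
  have h4 : m ^ 2 * d ^ 2 ≤ c₀ ^ 2 := by
    refine le_trans (le_of_eq ?_) hC
    rw [eq_div_iff hCa.ne', ← hdsq]; ring
  have h5 : 3 * c₀ ^ 2 * (m ^ 2 * τ ^ 2) ≤ c₀ ^ 2 := by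
    refine le_trans ?_ h4
    have := mul_le_mul_of_nonneg_left h3 (sq_nonneg (m : ℝ))
    linarith
  have h6 : 3 * (m ^ 2 * τ ^ 2) ≤ 1 := by
    have : c₀ ^ 2 * (3 * (m ^ 2 * τ ^ 2)) ≤ c₀ ^ 2 * 1 := by linarith
    exact le_of_mul_le_mul_left this (by positivity)
  linarith

/-- The crude triangle inequality suffices where both certificates are well below 1. -/
theorem norm_one_add_mul_sub_le {p q : ℂ} {g L : ℝ} (hL : 0 ≤ L) (hp : ‖p‖ ≤ 1 - g)
    (hq : ‖q‖ ≤ 1 - g) (hLg : 2 ≤ (2 + L) * g) : ‖(1 + (L : ℂ)) * p - q‖ ≤ L := by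
  have h1 : ‖(1 + (L : ℂ))‖ = 1 + L := by
    rw [← Complex.ofReal_one, ← Complex.ofReal_add, Complex.norm_of_nonneg (by linarith)]
  calc ‖(1 + (L : ℂ)) * p - q‖ ≤ (1 + L) * ‖p‖ + ‖q‖ := by
        refine (norm_sub_le _ _).trans ?_
        rw [norm_mul, h1]
    _ ≤ (1 + L) * (1 - g) + (1 - g) := by gcongr
    _ ≤ L := by linarith

/-- Near a common spike g tends to 0 and the triangle inequality fails. An exact quadratic identity
instead exploits that p and q are close and that |q| is almost 1; w plays the role of (mτ)², with τ
the arccos distance to the spike. -/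
theorem norm_one_add_mul_sub_le_of_close {p q : ℂ} {g w L : ℝ} (hL : 2 ≤ L) (hg : 0 ≤ g)
    (hp : ‖p‖ ≤ 1 - g) (hw : 0 ≤ w) (hq : 1 - w ≤ ‖q‖) (hpq : ‖p - q‖ ^ 2 ≤ 4 * w)
    (hLg : 9 * w ≤ (1 + L) * g) : ‖(1 + (L : ℂ)) * p - q‖ ≤ L := by
  apply le_of_sq_le_sq _ (by linarith)
  have hid : ‖(1 + (L : ℂ)) * p - q‖ ^ 2 =
      (1 + L) * L * ‖p‖ ^ 2 - L * ‖q‖ ^ 2 + (1 + L) * ‖p - q‖ ^ 2 := by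
    simp only [Complex.sq_norm, Complex.normSq_apply]
    simp
    ring
  rw [hid]
  have hg1 : g ≤ 1 := by linarith [norm_nonneg p]
  have hp2 : ‖p‖ ^ 2 ≤ 1 - g := by
    have := pow_le_pow_left₀ (norm_nonneg p) hp 2
    nlinarith
  have hq2 : 1 - 2 * w ≤ ‖q‖ ^ 2 := by
    rcases le_total w 1 with h | h
    · have := pow_le_pow_left₀ (by linarith) hq 2
      nlinarith
    · nlinarith [sq_nonneg ‖q‖]
  have e1 : (1 + L) * L * ‖p‖ ^ 2 ≤ (1 + L) * L * (1 - g) := by gcongr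
  have e2 : L * (1 - 2 * w) ≤ L * ‖q‖ ^ 2 := by gcongr
  have e3 : (1 + L) * ‖p - q‖ ^ 2 ≤ (1 + L) * (4 * w) := by gcongr
  have e4 : L * (9 * w) ≤ L * ((1 + L) * g) := by gcongr
  nlinarith [mul_nonneg (by linarith : (0 : ℝ) ≤ L - 2) hw]

end Certificate

/-! ### Localization of large atoms and detection of large spikes -/

section Recovery

variable {m s : ℕ} {T : Fin s → Dom} {a θ : Fin s → ℝ} {Ca Cb c₀ lam : ℝ} {e : Fin (m + 1) → ℝ}
  {μ : ComplexMeasure Dom} {α : Fin (m + 1) → ℂ}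

/-- A certificate bounds the defect of a solution and the error on its moments. -/
theorem IsCertificate.defect_le (hCa : 0 < Ca) (hCb : 0 < Cb) (ha : ∀ j, 0 ≤ a j) (hlam : 0 < lam)
    (he : ∑ k, e k ^ 2 ≤ lam ^ 2)
    (h : IsSolution m lam (fun k => moment k (spikes T a θ) + (e k : ℂ)) μ)
    (hα : IsCertificate T Ca Cb θ α) :
    tvNorm μ - (∑ k : Fin (m + 1), α k * moment k μ).re ≤ lam ∧
      Real.sqrt (∑ k : Fin (m + 1), ‖moment k μ - moment k (spikes T a θ)‖ ^ 2) ≤ 2 * lam := by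
  have hb := hα.norm_le_one hCa hCb
  have h1 := h.mul_defect_le hlam.le he (sum_norm_sq_le_one hb)
    (by rw [hα.re_sum_mul_moment_spikes, Complex.ofReal_re]; exact tvNorm_spikes_le T ha θ)
  have h2 := integral_one_sub_norm_le_defect α μ
  have h3 : 0 ≤ ∫ x, (1 - ‖chebSum α x‖) ∂μ.variation :=
    integral_nonneg fun x => sub_nonneg.2 (hb x)
  set N := Real.sqrt (∑ k : Fin (m + 1), ‖moment k μ - moment k (spikes T a θ)‖ ^ 2)
  have hN : 0 ≤ N := Real.sqrt_nonneg _
  constructor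
  · refine le_of_mul_le_mul_left (h1.trans ?_) hlam
    -- Completing the square: 2λN - N² ≤ λ².
    nlinarith [sq_nonneg (N - lam)]
  · have h4 := mul_nonneg hlam.le (h3.trans h2)
    rcases hN.eq_or_lt with h0 | h0
    · rw [← h0]; positivity
    · refine le_of_mul_le_mul_left (?_ : N * N ≤ N * (2 * lam)) h0
      nlinarith

theorem exists_mul_sq_le_of_large_atom (hQIC : QIC m T Ca Cb) (ha : ∀ j, 0 ≤ a j) (hlam : 0 < lam)
    (he : ∑ k, e k ^ 2 ≤ lam ^ 2)
    (h : IsSolution m lam (fun k => moment k (spikes T a θ) + (e k : ℂ)) μ) {x : Dom}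
    (hx : 2 * lam / Cb < ‖μ {x}‖) :
    ∃ k, Ca * m ^ 2 * |(x : ℝ) - T k| ^ 2 * ‖μ {x}‖ ≤ 2 * lam := by
  obtain ⟨hCa, hCb, hCb1, -⟩ := id hQIC
  rw [div_lt_iff₀ hCb] at hx
  -- With no spikes the infimum in QIC is over an empty set and equals 0, so it isolates nothing.
  -- The zero polynomial then serves as certificate and bounds the whole mass of μ by λ.
  rcases Nat.eq_zero_or_pos s with rfl | hs
  · exfalso
    have htv : tvNorm (spikes T a θ) ≤ 0 := by simpa using tvNorm_spikes_le T ha θ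
    have h1 := h.mul_defect_le hlam.le he (α := fun _ => 0) (by simp) (by simpa using htv)
    have h2 : ‖μ {x}‖ ≤ tvNorm μ :=
      le_trans VectorMeasure.norm_measure_le_variation (measureReal_mono (Set.subset_univ _))
    simp only [zero_mul, Finset.sum_const_zero, Complex.zero_re, sub_zero] at h1
    set N := Real.sqrt (∑ k : Fin (m + 1), ‖moment k μ - moment k (spikes T a θ)‖ ^ 2)
    have h3 : tvNorm μ ≤ lam := by
      refine le_of_mul_le_mul_left (h1.trans ?_) hlam
      nlinarith [sq_nonneg (N - lam)]
    nlinarith [norm_nonneg (μ {x})]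
  · obtain ⟨α, hα⟩ := hQIC.exists_isCertificate θ
    have hD := (hα.defect_le hCa hCb ha hlam he h).1
    have h1 := (norm_singleton_mul_le_defect (hα.norm_le_one hCa hCb) μ x).trans hD
    obtain ⟨k, hk⟩ := exists_min_le_iInf (m := m) (T := T) (Ca := Ca) (Cb := Cb) x ⟨0, hs⟩
    have h2 := mul_le_mul_of_nonneg_left (hk.trans (hα.isolates x)) (norm_nonneg (μ {x}))
    refine ⟨k, ?_⟩
    rw [Subtype.dist_eq, Real.dist_eq] at h2
    rcases min_choice (Ca * (m : ℝ) ^ 2 * |(x : ℝ) - T k| ^ 2) Cb with hmin | hmin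
    · rw [hmin] at h2; linarith
    · rw [hmin] at h2; linarith

/-- Large atoms of a solution are close to exactly one point of the true support. -/
theorem existsUnique_near_of_large_atom (hm : m ≠ 0) (hQIC : QIC m T Ca Cb) (hc₀ : 0 < c₀)
    (hedge : ∀ j, 2 * c₀ ≤ |(T j : ℝ) - 1| ∧ 2 * c₀ ≤ |(T j : ℝ) - (-1)|)
    (hC : Cb / Ca ≤ c₀ ^ 2) (ha : ∀ j, 0 ≤ a j) (hlam : 0 < lam) (he : ∑ k, e k ^ 2 ≤ lam ^ 2)
    (h : IsSolution m lam (fun k => moment k (spikes T a θ) + (e k : ℂ)) μ) {x : Dom}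
    (hx : 2 * lam / Cb < ‖μ {x}‖) :
    (∃! t : Dom, t ∈ Set.range T ∧
      |(x : ℝ) - t| ≤ Real.sqrt (2 * lam / (Ca * ‖μ {x}‖)) * (1 / m)) ∧
    Real.sqrt (2 * lam / (Ca * ‖μ {x}‖)) * (1 / m) ≤ c₀ / m := by
  obtain ⟨hCa, hCb, -, -⟩ := id hQIC
  have hm0 : (0 : ℝ) < m := by positivity
  have hμ : 0 < ‖μ {x}‖ := lt_trans (by positivity) hx
  obtain ⟨k, hk⟩ := exists_mul_sq_le_of_large_atom hQIC ha hlam he h hx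
  have hR : Real.sqrt (2 * lam / (Ca * ‖μ {x}‖)) < c₀ := by
    rw [Real.sqrt_lt' hc₀]
    refine lt_of_lt_of_le ?_ hC
    rw [div_lt_div_iff₀ (by positivity) hCa]
    rw [div_lt_iff₀ hCb] at hx
    nlinarith
  have hR' : Real.sqrt (2 * lam / (Ca * ‖μ {x}‖)) * (1 / m) < c₀ / m := by
    rw [mul_one_div]; gcongr
  have hnear : |(x : ℝ) - T k| ≤ Real.sqrt (2 * lam / (Ca * ‖μ {x}‖)) * (1 / m) := by
    rw [mul_one_div, le_div_iff₀ hm0]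
    apply Real.le_sqrt_of_sq_le
    rw [le_div_iff₀ (by positivity)]
    linarith
  refine ⟨⟨T k, ⟨⟨k, rfl⟩, hnear⟩, ?_⟩, hR'.le⟩
  rintro t ⟨⟨l, rfl⟩, hl⟩
  by_contra hne
  have hkl : l ≠ k := fun h => hne (by rw [h])
  have h1 := hQIC.separation hm hc₀ hedge hkl
  have h2 : |(T l : ℝ) - T k| ≤ |(x : ℝ) - T l| + |(x : ℝ) - T k| := by
    rw [abs_sub_comm (x : ℝ) (T l)]
    exact abs_sub_le _ _ _
  have h3 : 2 * c₀ / m = 2 * (c₀ / m) := by ring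
  linarith

/-- The combination of two certificates differing only by the sign at `T j` is bounded by `L`,
away from `T j`. -/
theorem norm_certificate_combination_le (hm : 2 ≤ m) (hQIC : QIC m T Ca Cb) (hc₀ : 0 < c₀)
    (hedge : ∀ j, 2 * c₀ ≤ |(T j : ℝ) - 1| ∧ 2 * c₀ ≤ |(T j : ℝ) - (-1)|)
    (hC : Cb / Ca ≤ c₀ ^ 2) {j : Fin s} {θ' : Fin s → ℝ} {β : Fin (m + 1) → ℂ}
    (hα : IsCertificate T Ca Cb θ α) (hβ : IsCertificate T Ca Cb θ' β)
    (hθ : ∀ k, k ≠ j → θ' k = θ k) {L : ℝ} (hL : 4 * (1 - Cb) / Cb ≤ L) {x : Dom}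
    (hx : 2 ≤ L * (Ca * m ^ 2 * |(x : ℝ) - T j| ^ 2)) :
    ‖(1 + (L : ℂ)) * chebSum α x - chebSum β x‖ ≤ L := by
  obtain ⟨hCa, hCb, -, -⟩ := id hQIC
  have hthird := hQIC.le_third hm hc₀ hedge hC j
  have hLCb : 4 * (1 - Cb) ≤ L * Cb := (div_le_iff₀ hCb).1 hL
  -- Since C_b ≤ 1/3, one has 4(1 - C_b)/C_b ≥ 8.
  have hL8 : 8 ≤ L := by nlinarith
  obtain ⟨k, hk⟩ := exists_min_le_iInf (m := m) (T := T) (Ca := Ca) (Cb := Cb) x j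
  have hp := hk.trans (hα.isolates x)
  have hq := hk.trans (hβ.isolates x)
  rw [Subtype.dist_eq, Real.dist_eq] at hp hq
  rcases min_cases (Ca * (m : ℝ) ^ 2 * |(x : ℝ) - T k| ^ 2) Cb with ⟨hmin, hle⟩ | ⟨hmin, -⟩
  · rw [hmin] at hp hq
    by_cases hkj : k = j
    · subst hkj
      refine norm_one_add_mul_sub_le (g := Ca * m ^ 2 * |(x : ℝ) - T k| ^ 2) (by linarith)
        (by linarith) (by linarith) (hx.trans ?_)
      gcongr
      linarith
    · have hnear : |(x : ℝ) - T k| ≤ c₀ / m :=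
        abs_sub_le_of_mul_sq_le (by omega) hc₀ hCa hC hle
      have hτ := three_mul_sq_mul_arccos_sub_sq_le_of_near hm hc₀ (abs_le_of_edge (hedge k)) hnear
      have hq' := one_sub_sq_le_norm_chebSum (by omega) (hβ.norm_le_one hCa hCb)
        (hβ.norm_eq_one k) x
      have ha' := norm_chebSum_sub_le (by omega) (hα.norm_le_one hCa hCb) x (T k)
      have hb' := norm_chebSum_sub_le (by omega) (hβ.norm_le_one hCa hCb) x (T k)
      have hab : chebSum α (T k) = chebSum β (T k) := by
        rw [hα.interpolates, hβ.interpolates, hθ k hkj]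
      set τ := |Real.arccos x - Real.arccos (T k)|
      have hpq : ‖chebSum α x - chebSum β x‖ ≤ 2 * (m * τ) := by
        have : chebSum α x - chebSum β x =
            (chebSum α x - chebSum α (T k)) - (chebSum β x - chebSum β (T k)) := by
          rw [hab]; ring
        rw [this]
        refine (norm_sub_le _ _).trans ?_
        linarith
      have hpq2 : ‖chebSum α x - chebSum β x‖ ^ 2 ≤ 4 * (m * τ) ^ 2 := by
        refine (pow_le_pow_left₀ (norm_nonneg _) hpq 2).trans (le_of_eq ?_)
        ring
      refine norm_one_add_mul_sub_le_of_close (g := Ca * m ^ 2 * |(x : ℝ) - T k| ^ 2)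
        (by linarith) (by positivity) (by linarith) (sq_nonneg _) hq' hpq2 ?_
      -- The condition on C_b/C_a compares the QIC drop with the Bernstein loss (mτ)²; the constant
      -- 3 comes from (1 + L)C_b ≥ 4 - 3C_b ≥ 3.
      have hCac : Cb ≤ c₀ ^ 2 * Ca := (div_le_iff₀ hCa).1 hC
      have hLC : 3 ≤ (1 + L) * (c₀ ^ 2 * Ca) := by
        have h1 : 3 ≤ (1 + L) * Cb := by linarith
        exact h1.trans (by gcongr)
      have h5 : c₀ ^ 2 * (9 * (m * τ) ^ 2) ≤
          c₀ ^ 2 * ((1 + L) * (Ca * m ^ 2 * |(x : ℝ) - T k| ^ 2)) := by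
        calc c₀ ^ 2 * (9 * (m * τ) ^ 2) = 3 * (m ^ 2 * (3 * c₀ ^ 2 * τ ^ 2)) := by ring
          _ ≤ 3 * (m ^ 2 * |(x : ℝ) - T k| ^ 2) := by gcongr
          _ ≤ (1 + L) * (c₀ ^ 2 * Ca) * (m ^ 2 * |(x : ℝ) - T k| ^ 2) := by gcongr
          _ = c₀ ^ 2 * ((1 + L) * (Ca * m ^ 2 * |(x : ℝ) - T k| ^ 2)) := by ring
      exact le_of_mul_le_mul_left h5 (by positivity)
  · rw [hmin] at hp hq
    exact norm_one_add_mul_sub_le (g := Cb) (by linarith) (by linarith) (by linarith)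
      (by linarith)

/-- The support of a solution meets a neighborhood of every large true spike. -/
theorem exists_mem_supp_near_of_large_spike (hm : 2 ≤ m) (hQIC : QIC m T Ca Cb) (hc₀ : 0 < c₀)
    (hedge : ∀ j, 2 * c₀ ≤ |(T j : ℝ) - 1| ∧ 2 * c₀ ≤ |(T j : ℝ) - (-1)|)
    (hC : Cb / Ca ≤ c₀ ^ 2) (ha : ∀ j, 0 ≤ a j) (hlam : 0 < lam) (he : ∑ k, e k ^ 2 ≤ lam ^ 2)
    (h : IsSolution m lam (fun k => moment k (spikes T a θ) + (e k : ℂ)) μ) {j : Fin s}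
    (hj : constC' Ca Cb * lam < a j) :
    ∃ t ∈ supp μ, |(T j : ℝ) - t| ≤
      Real.sqrt (2 * lam / (Ca * (a j - constC' Ca Cb * lam))) * (1 / m) := by
  obtain ⟨hCa, hCb, hCb1, -⟩ := id hQIC
  have hm0 : (0 : ℝ) < m := by positivity
  by_contra! hcon
  -- Only the lower bound by the first entry of the maximum matters, so the sign of C_a - C_b, or
  -- its vanishing, is harmless.
  obtain ⟨B, hB, hBC⟩ : ∃ B, constC' Ca Cb = 2 + B ∧ 2 * (1 - Cb) / Cb ≤ B :=
    ⟨_, rfl, le_max_left _ _⟩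
  have hB0 : 0 ≤ B := le_trans (div_nonneg (by linarith) hCb.le) hBC
  set A := a j - constC' Ca Cb * lam with hA
  have hA0 : 0 < A := by rw [hA]; linarith
  -- The term A/λ makes L C_a m²|x - T_j|² ≥ 2 outside the claimed radius; the term 2B gives L ≥ 4(1
  -- - C_b)/C_b.
  set L := A / lam + 2 * B with hLdef
  have hLA : L * lam = A + 2 * B * lam := by rw [hLdef]; field_simp
  have hL : 4 * (1 - Cb) / Cb ≤ L := by
    have h1 : 4 * (1 - Cb) / Cb = 2 * (2 * (1 - Cb) / Cb) := by ring
    have h2 : 0 < A / lam := by positivity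
    rw [h1, hLdef]; linarith
  set θ' : Fin s → ℝ := fun k => if k = j then θ k + Real.pi else θ k with hθ'
  obtain ⟨α, hα⟩ := hQIC.exists_isCertificate θ
  obtain ⟨β, hβ⟩ := hQIC.exists_isCertificate θ'
  have hsupp : ∀ x ∈ supp μ, ‖chebSum (fun k => (1 + (L : ℂ)) * α k - β k) x‖ ≤ L := by
    intro x hx
    rw [chebSum_mul_sub]
    refine norm_certificate_combination_le (j := j) hm hQIC hc₀ hedge hC hα hβ
      (fun k hk => by simp [hθ', hk]) hL ?_
    have h1 := hcon x hx
    have hpos : 0 < |(x : ℝ) - T j| := by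
      rw [abs_sub_comm]; exact lt_of_le_of_lt (by positivity) h1
    rw [abs_sub_comm, mul_one_div, div_lt_iff₀ hm0, Real.sqrt_lt' (by positivity),
      div_lt_iff₀ (by positivity)] at h1
    have h2 : A ≤ L * lam := by rw [hLA]; nlinarith
    have h3 : 0 ≤ Ca * m ^ 2 * |(x : ℝ) - T j| ^ 2 := by positivity
    have h4 := mul_le_mul_of_nonneg_right h2 h3
    refine le_of_mul_le_mul_right (?_ : 2 * lam ≤ _ * lam) hlam
    nlinarith
  have h1 := re_sum_mul_moment_le_of_supp _ μ hsupp
  obtain ⟨hD, hN⟩ := hα.defect_le hCa hCb ha hlam he h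
  have hαν := hα.re_sum_mul_moment_spikes a
  have hβν : ∑ k : Fin (m + 1), β k * moment k (spikes T a θ) =
      ((∑ i, a i - 2 * a j : ℝ) : ℂ) := by
    rw [sum_mul_moment_spikes]
    have hterm : ∀ i, chebSum β (T i) * (a i * Complex.exp (Complex.I * (θ i : ℂ))) =
        ((a i - if i = j then 2 * a i else 0 : ℝ) : ℂ) := by
      intro i
      rw [hβ.interpolates, mul_left_comm, ← Complex.exp_add]
      by_cases hi : i = j
      · have : -(Complex.I * ((θ' i : ℝ) : ℂ)) + Complex.I * θ i = -(Real.pi * Complex.I) := by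
          simp only [hθ', if_pos hi]; push_cast; ring
        rw [this, Complex.exp_neg, Complex.exp_pi_mul_I, if_pos hi]
        push_cast
        norm_num
        ring
      · have : -(Complex.I * ((θ' i : ℝ) : ℂ)) + Complex.I * θ i = 0 := by
          simp only [hθ', if_neg hi]; ring
        rw [this, if_neg hi]
        simp
    simp_rw [hterm]
    rw [← Complex.ofReal_sum, Finset.sum_sub_distrib]
    simp
  set H : Fin (m + 1) → ℂ := fun k => moment k μ - moment k (spikes T a θ) with hH
  have hαH : ‖∑ k, α k * H k‖ ≤ 2 * lam :=
    (norm_sum_mul_le_sqrt _ (sum_norm_sq_le_one (hα.norm_le_one hCa hCb))).trans hN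
  have hβH : ‖∑ k, β k * H k‖ ≤ 2 * lam :=
    (norm_sum_mul_le_sqrt _ (sum_norm_sq_le_one (hβ.norm_le_one hCa hCb))).trans hN
  have hsplit : ∀ γ : Fin (m + 1) → ℂ, ∑ k : Fin (m + 1), γ k * moment k μ =
      ∑ k : Fin (m + 1), γ k * moment k (spikes T a θ) + ∑ k, γ k * H k := by
    intro γ
    rw [← Finset.sum_add_distrib]
    exact Finset.sum_congr rfl fun k _ => by rw [hH]; ring
  have hcomb : (∑ k : Fin (m + 1), ((1 + (L : ℂ)) * α k - β k) * moment k μ).re =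
      (1 + L) * (∑ k : Fin (m + 1), α k * moment k μ).re -
        (∑ k : Fin (m + 1), β k * moment k μ).re := by
    have : ∑ k : Fin (m + 1), ((1 + (L : ℂ)) * α k - β k) * moment k μ =
        ((1 + L : ℝ) : ℂ) * ∑ k : Fin (m + 1), α k * moment k μ -
          ∑ k : Fin (m + 1), β k * moment k μ := by
      rw [Finset.mul_sum, ← Finset.sum_sub_distrib]
      refine Finset.sum_congr rfl fun k _ => ?_
      push_cast
      ring
    rw [this, Complex.sub_re, Complex.re_ofReal_mul]
  rw [hcomb] at h1
  have hαμ := congrArg Complex.re (hsplit α)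
  have hβμ := congrArg Complex.re (hsplit β)
  rw [hαν, Complex.add_re, Complex.ofReal_re] at hαμ
  rw [hβν, Complex.add_re, Complex.ofReal_re] at hβμ
  have hα1 := (abs_le.1 ((Complex.abs_re_le_norm _).trans hαH)).1
  have hβ1 := (abs_le.1 ((Complex.abs_re_le_norm _).trans hβH)).2
  have hL0 : 0 ≤ L := le_trans (div_nonneg (by linarith) hCb.le) hL
  have hLD := mul_le_mul_of_nonneg_left hD hL0
  have hAj : a j = A + (2 + B) * lam := by rw [hA, hB]; ring
  -- The two bounds on Re ∫ (P - Q) dμ give 2a_j ≤ (4 + L)λ. With a_j = A + (2 + B)λ and Lλ = A +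
  -- 2Bλ this reads A ≤ 0.
  nlinarith

end Recovery

end MomentBlasso

end

theorem mainTheorem4 {Ω : Type*} [MeasurableSpace Ω] (Pr : Measure Ω) [IsProbabilityMeasure Pr]
    (m : ℕ) (hm : 9 ≤ m)
    (s : ℕ) (T : Fin s → MomentBlasso.Dom) (hT : Function.Injective T)
    (a θ : Fin s → ℝ) (ha : ∀ j, 0 < a j)
    (c₀ Ca Cb : ℝ) (hc₀ : 0 < c₀)
    (hedge : ∀ j, 2 * c₀ ≤ |(T j : ℝ) - 1| ∧ 2 * c₀ ≤ |(T j : ℝ) - (-1)|)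
    (hQIC : MomentBlasso.QIC m T Ca Cb) (hC : Cb / Ca ≤ c₀ ^ 2)
    (σ : ℝ) (hσ : 0 < σ)
    (ε : Fin (m + 1) → Ω → ℝ) (hindep : iIndepFun ε Pr)
    (hgauss : ∀ k, HasLaw (ε k) (gaussianReal 0 (σ ^ 2).toNNReal) Pr)
    (lam : ℝ) (hlam : MomentBlasso.lamM m σ ≤ lam) :
    ∃ E : Set Ω, MeasurableSet E ∧
      1 - 8 * Real.sqrt 6 / Real.sqrt (2 * Real.pi) * (lam / MomentBlasso.lamM m σ) *
          Real.sqrt (Real.log m) *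
          Real.exp (-((2 * (lam ^ 2 / MomentBlasso.lamM m σ ^ 2) - 1) * Real.log m))
        < Pr.real E ∧
      ∀ ω ∈ E, ∀ Δhat : ComplexMeasure MomentBlasso.Dom,
        MomentBlasso.IsSolution m lam
          (fun k => MomentBlasso.moment k (MomentBlasso.spikes T a θ) + (ε k ω : ℂ)) Δhat →
        (∀ x : MomentBlasso.Dom, 2 * lam / Cb < ‖Δhat {x}‖ →
          (∃! t : MomentBlasso.Dom, t ∈ Set.range T ∧
            |(x : ℝ) - t| ≤ Real.sqrt (2 * lam / (Ca * ‖Δhat {x}‖)) * (1 / m)) ∧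
          Real.sqrt (2 * lam / (Ca * ‖Δhat {x}‖)) * (1 / m) ≤ c₀ / m) ∧
        (∀ j, MomentBlasso.constC' Ca Cb * lam < a j →
          ∃ t ∈ MomentBlasso.supp Δhat,
            |(T j : ℝ) - t| ≤
              Real.sqrt (2 * lam / (Ca * (a j - MomentBlasso.constC' Ca Cb * lam))) * (1 / m)) := by
  have hlam0 : 0 < lam := (MomentBlasso.lamM_pos hm hσ).trans_le hlam
  obtain ⟨E, hE, hPr, hnoise⟩ := MomentBlasso.exists_noise_event Pr hm hσ hgauss hlam
  refine ⟨E, hE, hPr, fun ω hω Δhat hsol => ⟨fun x hx => ?_, fun j hj => ?_⟩⟩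
  · exact MomentBlasso.existsUnique_near_of_large_atom (by omega) hQIC hc₀ hedge hC
      (fun j => (ha j).le) hlam0 (hnoise ω hω) hsol hx
  · exact MomentBlasso.exists_mem_supp_near_of_large_spike (by omega) hQIC hc₀ hedge hC
      (fun j => (ha j).le) hlam0 (hnoise ω hω) hsol hj
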